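/- Let $\Lambda=\{\lambda_1<\cdots<\lambda_n\}\subset\mathbb{R}$ be strongly disjoint: any two nonempty disjoint subsets of $\Lambda$ have different means. Let $\mathrm{Sym}(\Lambda)$ be the manifold of real symmetric $n\times n$ matrices with eigenvalues $\lambda_1,\dots,\lambda_n$, whose tangent space at $H$ is $\{[H,\Omega]:\Omega^T=-\Omega\}$, with the normal metric $g([H,\Omega_1],[H,\Omega_2])=-\mathrm{tr}(\Omega_1\Omega_2)$, and let $\Psi(H)=\frac12\sum_i h_{ii}^2$ on $\mathrm{Sym}(\Lambda)$. For an ordered partition $\alpha=(\Lambda_1,\dots,\Lambda_k)$ of $\Lambda$ into nonempty blocks, let $E_\alpha$ be the set of block diagonal matrices $\mathrm{Diag}(H_1,\dots,H_k)$ where $H_p$ is symmetric with set of eigenvalues $\Lambda_p$ (and size $\#\Lambda_p$) and all diagonal entries of $H_p$ equal the mean of $\Lambda_p$. The critical manifolds are the sets $P^TE_\alpha P$ with $P$ a permutation matrix. The co-index of a critical manifold $M$ (at a point $H\in M$) is the number of positive eigenvalues, with multiplicity and with respect to $g$, of the Hessian of $\Psi$ at $H$ restricted to the normal space of $M$ in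 $\mathrm{Sym}(\Lambda)$ at $H$. (1) If $E_\alpha$ has co-index $1$ (at some point), then all blocks of $\alpha$ are singletons except exactly one block, and this block is $\{\lambda_i,\lambda_{i+1}\}$ for some $i$. (2) Every critical manifold of co-index $1$ (at some point) consists of exactly two points and equals $K_{\sigma_1,\sigma_2}$ for some permutations $\sigma_1,\sigma_2$ of $\{1,\dots,n\}$ related by a simple transposition, i.e. $\sigma_2=(i\ i{+}1)\circ\sigma_1$ for some $i$. Here $K_{\sigma_1,\sigma_2}$ consists of the two matrices whose entries in the rows and columns $x=\sigma_1^{-1}(i)$ and $y=\sigma_1^{-1}(i+1)$ are $h_{xx}=h_{yy}=\frac12(\lambda_i+\lambda_{i+1})$ and $h_{xy}=h_{yx}=\pm\frac12(\lambda_i-\lambda_{i+1})$, whose other diagonal entries are $h_{zz}=\lambda_{\sigma_1(z)}$, and whose other off-diagonal entries are $0$. (3) Conversely, whenever $\sigma_1$ and $\sigma_2$ are related by a simple transposition, $K_{\sigma_1,\sigma_2}$ is a critical manifold, and it has co-index $1$ at each of its points. -/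

import Mathlib

open Matrix Polynomial

noncomputable section

namespace Isospectral

/-- The eigenvalues `lam 0, …, lam (n-1)` are strongly disjoint: two nonempty disjoint
subfamilies never have the same mean. -/
def StronglyDisjoint {n : ℕ} (lam : Fin n → ℝ) : Prop :=
  ∀ A B : Finset (Fin n), A.Nonempty → B.Nonempty → Disjoint A B →
    (∑ a ∈ A, lam a) / (A.card : ℝ) ≠ (∑ b ∈ B, lam b) / (B.card : ℝ)

/-- The isospectral set `Sym({lam a | a ∈ S})`: real symmetric matrices whose eigenvalues,
with multiplicity, are the `lam a`, `a ∈ S`. -/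
def symSet {n : ℕ} (lam : Fin n → ℝ) (S : Finset (Fin n)) (ι : Type) [Fintype ι]
    [DecidableEq ι] : Set (Matrix ι ι ℝ) :=
  {H | H.IsSymm ∧ H.charpoly = ∏ a ∈ S, (X - C (lam a))}

/-! ### Partitions of the eigenvalues, and the critical manifolds -/

/-- A partition of the (indices of the) eigenvalues into `k` nonempty blocks, listed in some
order: `label a` is the number of the block that contains `lam a`. -/
structure BlockPartition (n : ℕ) where
  k : ℕ
  label : Fin n → Fin k
  surj : Function.Surjective label

namespace BlockPartition

variable {n : ℕ} (α : BlockPartition n)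

/-- The `p`-th block. -/
def part (p : Fin α.k) : Finset (Fin n) := Finset.univ.filter fun a => α.label a = p

/-- The number of eigenvalues in the `p`-th block. -/
def size (p : Fin α.k) : ℕ := (α.part p).card

/-- The mean of the eigenvalues in the `p`-th block. -/
def mean (lam : Fin n → ℝ) (p : Fin α.k) : ℝ := (∑ a ∈ α.part p, lam a) / (α.size p : ℝ)

theorem sum_size : ∑ p, α.size p = n := by
  have h := Finset.card_eq_sum_card_fiberwise (s := (Finset.univ : Finset (Fin n)))
    (t := (Finset.univ : Finset (Fin α.k))) (f := α.label) (fun _ _ => by simp)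
  simpa [size, part] using h.symm

/-- The identification of the rows of a block matrix with diagonal blocks of sizes
`size 0, size 1, …` with `Fin n`, in lexicographic order. -/
def rows : (Σ p : Fin α.k, Fin (α.size p)) ≃ Fin n :=
  finSigmaFinEquiv.trans (finCongr α.sum_size)

/-- The set of block diagonal matrices `Diag(H_1, …, H_k)` in which `H_p` has the eigenvalues
of the `p`-th block, and all its diagonal entries equal their mean. -/
def critSet (lam : Fin n → ℝ) : Set (Matrix (Fin n) (Fin n) ℝ) :=
  {H | ∃ B : ∀ p : Fin α.k, Matrix (Fin (α.size p)) (Fin (α.size p)) ℝ,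
      (∀ p, B p ∈ symSet lam (α.part p) (Fin (α.size p)) ∧ ∀ i, B p i i = α.mean lam p) ∧
      H = Matrix.reindex α.rows α.rows (Matrix.blockDiagonal' B)}

end BlockPartition

variable {n : ℕ}

/-- The critical manifolds: the sets in the orbits of the `α.critSet lam` under conjugation by
permutation matrices. -/
def IsCriticalManifold (lam : Fin n → ℝ) (M : Set (Matrix (Fin n) (Fin n) ℝ)) : Prop :=
  ∃ (α : BlockPartition n) (τ : Equiv.Perm (Fin n)),
    M = (fun H => (τ.permMatrix ℝ)ᵀ * H * τ.permMatrix ℝ) '' α.critSet lam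

/-! ### The normal metric, the diagonal potential and its Hessian -/

/-- The tangent space at `H` of the isospectral manifold: all `[H, Ω]`, `Ω` skew symmetric. -/
def tangent (H : Matrix (Fin n) (Fin n) ℝ) : Set (Matrix (Fin n) (Fin n) ℝ) :=
  {V | ∃ Ω : Matrix (Fin n) (Fin n) ℝ, Ωᵀ = -Ω ∧ ⁅H, Ω⁆ = V}

open Classical in
/-- The skew symmetric `Ω` with `[H, Ω] = V`, for `V` tangent at `H`. It is unique when `H` is
symmetric with distinct eigenvalues. The value is `0` if `V` is not tangent. -/
def adInv (H V : Matrix (Fin n) (Fin n) ℝ) : Matrix (Fin n) (Fin n) ℝ :=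
  if h : ∃ Ω : Matrix (Fin n) (Fin n) ℝ, Ωᵀ = -Ω ∧ ⁅H, Ω⁆ = V then h.choose else 0

/-- The normal metric `g([H, Ω₁], [H, Ω₂]) = -tr(Ω₁ Ω₂)` at `H`. -/
def normalMetric (H V W : Matrix (Fin n) (Fin n) ℝ) : ℝ :=
  -(adInv H V * adInv H W).trace

/-- The diagonal potential, half the sum of the squares of the diagonal entries. -/
def potential (H : Matrix (Fin n) (Fin n) ℝ) : ℝ := (1 / 2) * ∑ i, H i i ^ 2

/-- The Hessian at a critical point `H` of the diagonal potential restricted to the isospectral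
manifold: the derivative at `H`, in the direction `V`, of the derivative of the potential along
a tangent vector field `W̃` with `W̃(H) = W`. The field is `W̃(K) = [K, Ω]` with `W = [H, Ω]`.
(At a critical point this is the covariant Hessian, whatever the connection and `W̃`.) -/
def hessian (H V W : Matrix (Fin n) (Fin n) ℝ) : ℝ :=
  lineDeriv ℝ (fun K => lineDeriv ℝ potential K ⁅K, adInv H W⁆) H V

/-- The tangent vectors at `H` of a submanifold `M` of the space of matrices: velocities of
smooth curves in `M` through `H`. -/
def velocities (M : Set (Matrix (Fin n) (Fin n) ℝ)) (H : Matrix (Fin n) (Fin n) ℝ) :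
    Set (Matrix (Fin n) (Fin n) ℝ) :=
  {V | ∃ γ : ℝ → Matrix (Fin n) (Fin n) ℝ, (∀ i j, ContDiff ℝ (⊤ : ℕ∞) fun t => γ t i j) ∧
      (∀ t, γ t ∈ M) ∧ γ 0 = H ∧ ∀ i j, HasDerivAt (fun t => γ t i j) (V i j) 0}

/-- The normal space at `H` of a submanifold `M` of the isospectral manifold: the tangent vectors
of the isospectral manifold that are orthogonal, in the normal metric, to those of `M`. -/
def normalSpace (M : Set (Matrix (Fin n) (Fin n) ℝ)) (H : Matrix (Fin n) (Fin n) ℝ) :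
    Set (Matrix (Fin n) (Fin n) ℝ) :=
  {V | V ∈ tangent H ∧ ∀ W ∈ velocities M H, normalMetric H V W = 0}

/-- The eigenvectors, with eigenvalue `c`, of the Hessian restricted to the normal space
(and the zero vector). -/
def hessianEigenvectors (M : Set (Matrix (Fin n) (Fin n) ℝ)) (H : Matrix (Fin n) (Fin n) ℝ)
    (c : ℝ) : Set (Matrix (Fin n) (Fin n) ℝ) :=
  {V | V ∈ normalSpace M H ∧ ∀ W ∈ normalSpace M H, hessian H V W = c * normalMetric H V W}

/-- The co-index of `M`, computed at its point `H`: the number, with multiplicity, of positive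
eigenvalues of the Hessian restricted to the normal space, that is, the dimension of the sum of
the eigenspaces for positive eigenvalues. -/
def coindexAt (M : Set (Matrix (Fin n) (Fin n) ℝ)) (H : Matrix (Fin n) (Fin n) ℝ) : ℕ :=
  Module.finrank ℝ (Submodule.span ℝ (⋃ c ∈ Set.Ioi (0 : ℝ), hessianEigenvectors M H c))

/-! ### The two-point sets -/

/-- `σ₂` is obtained from `σ₁` by exchanging two consecutive values `i`, `i + 1`. -/
def SimplyRelated (σ₁ σ₂ : Equiv.Perm (Fin n)) : Prop :=
  ∃ i j : Fin n, (j : ℕ) = (i : ℕ) + 1 ∧ σ₂ = Equiv.swap i j * σ₁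

/-- For `σ₂ = (i j) ∘ σ₁` this matrix has, on the rows and columns `x = σ₁⁻¹ i` and
`y = σ₁⁻¹ j`, diagonal entries `(lam i + lam j) / 2` and off-diagonal entries
`ε |lam i - lam j| / 2`; elsewhere it is the diagonal matrix with entries `lam (σ₁ z)`. -/
def pairMatrix (lam : Fin n → ℝ) (σ₁ σ₂ : Equiv.Perm (Fin n)) (ε : ℝ) :
    Matrix (Fin n) (Fin n) ℝ :=
  Matrix.of fun x y =>
    if x = y then (lam (σ₁ x) + lam (σ₂ x)) / 2
    else if σ₁ x = σ₂ y then ε * |lam (σ₁ x) - lam (σ₁ y)| / 2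
    else 0

/-- The set `K_{σ₁, σ₂}`. -/
def pairSet (lam : Fin n → ℝ) (σ₁ σ₂ : Equiv.Perm (Fin n)) :
    Set (Matrix (Fin n) (Fin n) ℝ) :=
  {pairMatrix lam σ₁ σ₂ 1, pairMatrix lam σ₁ σ₂ (-1)}

end Isospectral

end

/-! At a critical point `H` with block means `m`, pick orthonormal eigenvectors supported in the
blocks, as the columns of `U`. Tangent vectors are `[H, A]` with `A` skew, and in this frame
(`IsFrame.hessian_lie`) the Hessian of `[H, A]` with itself is the sum of the squares of the
diagonal entries of `[H, A]`, minus the sum over `a, b` of `(m_a - m_b)(λ_a - λ_b) A'_ab²`, where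
`A' = Uᵀ A U` and `m_a` is the mean of the block of `λ_a`.

Positive directions therefore have two sources. For diagonal `D` the vector `[H, [D, H]]` is normal,
and only the squares contribute; they vanish only if `D` commutes with `H`. Strong disjointness
makes the blocks of `H` irreducible (`eq_of_lie_diagonal_eq_zero`), so then `D` is scalar on each
block. The other source is an inversion: two eigenvalues whose block means come in the opposite
order. It makes the second sum contribute positively along a rotation of the two eigenvectors, which
is again normal.

If all blocks are singletons there is no source of either kind and the co-index is `0`. Two
independent diagonal directions, or one of them with an inversion, give a plane on which the Hessian
is positive definite, so the co-index is at least `2` (`IsFrame.one_lt_coindexAt`). Co-index `1`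
thus leaves a single pair `{λ_i, λ_j}` without inversions. An eigenvalue strictly between them
differs from their mean by strong disjointness, hence is inverted with one of them; so the pair is
consecutive.

Such a block is a `2 × 2` matrix with prescribed trace, determinant and equal diagonal entries,
which leaves only the sign of the off-diagonal entry: two points (`blockSet_eq_pairSet`).
Conversely, merging consecutive eigenvalues creates no inversion, and the rotation in the coordinate
plane of the pair spans all positive eigenspaces (`coindexAt_eq_one`). -/

namespace Isospectral

/-! ### Critical manifolds described by eigenvectors -/

theorem charpoly_eq_prod_iff {n : ℕ} {lam : Fin n → ℝ} (hlam : Function.Injective lam)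
    {ι : Type} [Fintype ι] [DecidableEq ι] (S : Finset (Fin n)) (hS : Fintype.card ι = S.card)
    (B : Matrix ι ι ℝ) :
    B.charpoly = ∏ a ∈ S, (X - C (lam a)) ↔ ∀ a ∈ S, ∃ v ≠ 0, B *ᵥ v = lam a • v := by
  have key : ∀ c : ℝ, B.charpoly.IsRoot c ↔ ∃ v ≠ 0, B *ᵥ v = c • v := by
    intro c
    rw [IsRoot, Matrix.eval_charpoly, ← Matrix.exists_mulVec_eq_zero_iff]
    refine exists_congr fun v => and_congr_right fun _ => ?_
    rw [Matrix.sub_mulVec, sub_eq_zero, eq_comm, Matrix.scalar_apply, ← Matrix.smul_one_eq_diagonal,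
      Matrix.smul_mulVec, Matrix.one_mulVec]
  constructor
  · intro h a ha
    rw [← key, h, IsRoot, eval_prod]
    exact Finset.prod_eq_zero ha (by simp)
  · intro h
    have hmon : (∏ a ∈ S, (X - C (lam a))).Monic := monic_prod_X_sub_C lam S
    -- The eigenvalues are distinct, so the linear factors are coprime and their product divides the
    -- characteristic polynomial; both are monic of the same degree.
    refine (eq_of_monic_of_dvd_of_natDegree_le hmon B.charpoly_monic ?_ ?_)
    · refine Finset.prod_dvd_of_coprime ?_ ?_
      · exact fun a _ b _ hab => pairwise_coprime_X_sub_C hlam hab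
      · exact fun a ha => dvd_iff_isRoot.2 ((key _).2 (h a ha))
    · rw [B.charpoly_natDegree_eq_dim, natDegree_finsetProd_X_sub_C_eq_card, hS]

namespace BlockPartition

variable {n : ℕ} (α : BlockPartition n)

theorem mem_part {p : Fin α.k} {a : Fin n} : a ∈ α.part p ↔ α.label a = p := by
  simp [part]

/-- The indices of the eigenvalues, listed block by block. -/
noncomputable def blockEquiv : (Σ p : Fin α.k, Fin (α.size p)) ≃ Fin n :=
  (Equiv.sigmaCongrRight fun p =>
    (α.part p).equivFin.symm.trans (Equiv.subtypeEquivRight fun _ => α.mem_part)).trans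
    (Equiv.sigmaFiberEquiv α.label)

theorem label_blockEquiv (x : Σ p : Fin α.k, Fin (α.size p)) : α.label (α.blockEquiv x) = x.1 :=
  (Equiv.subtypeEquivRight (fun _ => α.mem_part) ((α.part x.1).equivFin.symm x.2)).2

/-- The block matrices of `critSet`, with the rows permuted so that row `x` belongs to the block
of `lam (σ x)`; the eigenvalues of the blocks are expressed through eigenvectors. -/
def blockSet (lam : Fin n → ℝ) (σ : Equiv.Perm (Fin n)) : Set (Matrix (Fin n) (Fin n) ℝ) :=
  {H | H.IsSymm ∧ (∀ x y, α.label (σ x) ≠ α.label (σ y) → H x y = 0) ∧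
    (∀ x, H x x = α.mean lam (α.label (σ x))) ∧
    ∀ a, ∃ v ≠ 0, (∀ x, α.label (σ x) ≠ α.label a → v x = 0) ∧ H *ᵥ v = lam a • v}

theorem submatrix_mem_blockSet (lam : Fin n → ℝ) (σ τ : Equiv.Perm (Fin n))
    {H : Matrix (Fin n) (Fin n) ℝ} (hH : H ∈ α.blockSet lam σ) :
    H.submatrix τ τ ∈ α.blockSet lam (σ * τ) := by
  obtain ⟨h1, h2, h3, h4⟩ := hH
  refine ⟨h1.submatrix τ, fun x y h => h2 _ _ h, fun x => h3 _, fun a => ?_⟩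
  obtain ⟨v, hv, hs, he⟩ := h4 a
  refine ⟨v ∘ τ, fun h => hv ?_, fun x hx => hs _ hx, ?_⟩
  · funext x
    simpa using congrFun h (τ.symm x)
  · funext x
    have := congrFun he (τ x)
    simp only [mulVec, dotProduct, submatrix_apply, Function.comp, Pi.smul_apply] at this ⊢
    rw [← this]
    exact Equiv.sum_comp τ fun y => H (τ x) y * v y

theorem image_permMatrix_blockSet (lam : Fin n → ℝ) (σ τ : Equiv.Perm (Fin n)) :
    (fun H => (τ.permMatrix ℝ)ᵀ * H * τ.permMatrix ℝ) '' α.blockSet lam σ =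
      α.blockSet lam (σ * τ⁻¹) := by
  have h : (fun H : Matrix (Fin n) (Fin n) ℝ => (τ.permMatrix ℝ)ᵀ * H * τ.permMatrix ℝ) =
      fun H => H.submatrix (τ⁻¹ : Equiv.Perm _) (τ⁻¹ : Equiv.Perm _) := by
    funext H
    rw [transpose_permMatrix, PEquiv.toMatrix_toPEquiv_mul, PEquiv.mul_toMatrix_toPEquiv]
    rfl
  rw [h]
  ext K
  constructor
  · rintro ⟨H, hH, rfl⟩
    exact α.submatrix_mem_blockSet lam σ τ⁻¹ hH
  · intro hK
    refine ⟨K.submatrix τ τ, ?_, ?_⟩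
    · simpa using α.submatrix_mem_blockSet lam _ τ hK
    · ext; simp

theorem blockDiagonal_mulVec {k : ℕ} {s : Fin k → ℕ} (B : ∀ p, Matrix (Fin (s p)) (Fin (s p)) ℝ)
    (w : (Σ p, Fin (s p)) → ℝ) (p : Fin k) (i : Fin (s p)) :
    (blockDiagonal' B *ᵥ w) ⟨p, i⟩ = (B p *ᵥ fun j => w ⟨p, j⟩) i := by
  simp only [mulVec, dotProduct, Fintype.sum_sigma]
  rw [Finset.sum_eq_single p]
  · simp [blockDiagonal'_apply_eq]
  · intro q _ hq
    exact Finset.sum_eq_zero fun j _ => by rw [blockDiagonal'_apply_ne _ _ _ hq.symm, zero_mul]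
  · simp

/-- The permutation sends a row to its place in the block matrix and on to an eigenvalue of the same
block. Which eigenvalue of the block is immaterial, since `blockSet` sees `σ` only through the
labels. -/
theorem critSet_eq_blockSet {lam : Fin n → ℝ} (hlam : Function.Injective lam) :
    α.critSet lam = α.blockSet lam (α.rows.symm.trans α.blockEquiv) := by
  have hlab : ∀ x, α.label ((α.rows.symm.trans α.blockEquiv) x) = (α.rows.symm x).1 :=
    fun x => α.label_blockEquiv _
  have hchar : ∀ p (B : Matrix (Fin (α.size p)) (Fin (α.size p)) ℝ),
      B.charpoly = ∏ a ∈ α.part p, (X - C (lam a)) ↔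
        ∀ a ∈ α.part p, ∃ v ≠ 0, B *ᵥ v = lam a • v :=
    fun p B => charpoly_eq_prod_iff hlam _ (Fintype.card_fin _) B
  have hmul : ∀ (K : Matrix (Σ p, Fin (α.size p)) (Σ p, Fin (α.size p)) ℝ) (w : _ → ℝ) x,
      (K.submatrix α.rows.symm α.rows.symm *ᵥ (w ∘ α.rows.symm)) x =
        (K *ᵥ w) (α.rows.symm x) := by
    intro K w x
    simp only [mulVec, dotProduct, submatrix_apply, Function.comp]
    exact Equiv.sum_comp α.rows.symm fun y => K (α.rows.symm x) y * w y
  ext H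
  simp only [blockSet, hlab, Set.mem_ofPred_eq, critSet]
  constructor
  · rintro ⟨B, hB, rfl⟩
    refine ⟨?_, ?_, ?_, ?_⟩
    · have : (blockDiagonal' B).IsSymm := by
        rw [Matrix.IsSymm, blockDiagonal'_transpose]
        exact congrArg _ (funext fun p => (hB p).1.1)
      exact this.submatrix _
    · intro x y hxy
      exact blockDiagonal'_apply_ne B _ _ hxy
    · intro x
      rw [reindex_apply, submatrix_apply]
      rw [← (hB (α.rows.symm x).1).2 (α.rows.symm x).2]
      exact blockDiagonal'_apply_eq B _ _ _
    · intro a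
      obtain ⟨v, hv, he⟩ := (hchar _ _).1 (hB (α.label a)).1.2 a (α.mem_part.2 rfl)
      let w : (Σ p, Fin (α.size p)) → ℝ := fun x =>
        (Pi.single (M := fun p => Fin (α.size p) → ℝ) (α.label a) v) x.1 x.2
      refine ⟨w ∘ α.rows.symm, ?_, ?_, ?_⟩
      · intro h0
        refine hv (funext fun i => ?_)
        have := congrFun h0 (α.rows ⟨α.label a, i⟩)
        simp only [w, Function.comp, Equiv.symm_apply_apply] at this
        simpa using this
      · intro x hx
        simp [w, Pi.single_eq_of_ne hx]
      · funext x
        rw [reindex_apply, hmul]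
        obtain ⟨⟨p, i⟩, rfl⟩ := α.rows.surjective x
        simp only [Equiv.symm_apply_apply, Pi.smul_apply, Function.comp]
        rw [blockDiagonal_mulVec]
        by_cases hp : p = α.label a
        · subst hp
          simpa [w] using congrFun he i
        · have : (fun j => w ⟨p, j⟩) = 0 := by
            funext j; simp [w, Pi.single_eq_of_ne hp]
          rw [this]
          simp [w, Pi.single_eq_of_ne hp]
  · rintro ⟨h1, h2, h3, h4⟩
    have hblock : H = reindex α.rows α.rows
        (blockDiagonal' fun p => of fun i j => H (α.rows ⟨p, i⟩) (α.rows ⟨p, j⟩)) := by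
      ext x y
      obtain ⟨⟨p, i⟩, rfl⟩ := α.rows.surjective x
      obtain ⟨⟨q, j⟩, rfl⟩ := α.rows.surjective y
      simp only [reindex_apply, submatrix_apply, Equiv.symm_apply_apply]
      by_cases hpq : p = q
      · subst hpq
        rw [blockDiagonal'_apply_eq]; rfl
      · rw [blockDiagonal'_apply_ne _ _ _ hpq]
        exact h2 _ _ (by simpa using hpq)
    refine ⟨_, fun p => ⟨⟨?_, (hchar _ _).2 ?_⟩, fun i => ?_⟩, hblock⟩
    · ext i j
      exact h1.apply _ _
    · intro a ha
      obtain ⟨v, hv, hs, he⟩ := h4 a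
      rw [mem_part] at ha
      subst ha
      refine ⟨fun i => v (α.rows ⟨_, i⟩), fun h0 => hv (funext fun x => ?_), funext fun i => ?_⟩
      · by_cases hx : (α.rows.symm x).1 = α.label a
        · obtain ⟨⟨p, i⟩, rfl⟩ := α.rows.surjective x
          simp only [Equiv.symm_apply_apply] at hx
          subst hx
          exact congrFun h0 i
        · exact hs x hx
      · have h5 := congrFun he (α.rows ⟨α.label a, i⟩)
        rw [hblock] at h5
        have h6 := hmul (blockDiagonal' fun p => of fun i j => H (α.rows ⟨p, i⟩) (α.rows ⟨p, j⟩))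
          (v ∘ α.rows) (α.rows ⟨α.label a, i⟩)
        rw [Function.comp_assoc, Equiv.self_comp_symm, Function.comp_id, ← reindex_apply, h5,
          Equiv.symm_apply_apply, blockDiagonal_mulVec] at h6
        exact h6.symm
    · simpa using h3 (α.rows ⟨p, i⟩)

end BlockPartition

/-- Conjugation by `τ` replaces `σ` by `σ * τ⁻¹`, which runs over all permutations. This absorbs the
permutation action into the parameter `σ` of `blockSet`. -/
theorem isCriticalManifold_iff {n : ℕ} {lam : Fin n → ℝ} (hlam : Function.Injective lam)
    (M : Set (Matrix (Fin n) (Fin n) ℝ)) :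
    IsCriticalManifold lam M ↔
      ∃ (α : BlockPartition n) (σ : Equiv.Perm (Fin n)), M = α.blockSet lam σ := by
  refine exists_congr fun α => ?_
  rw [α.critSet_eq_blockSet hlam]
  simp only [α.image_permMatrix_blockSet]
  constructor
  · rintro ⟨τ, h⟩
    exact ⟨_, h⟩
  · rintro ⟨σ, h⟩
    refine ⟨σ⁻¹ * (α.rows.symm.trans α.blockEquiv), ?_⟩
    rw [h]
    congr 1
    ext x
    simp

end Isospectral

/-! ### Eigenvector frames, irreducibility of the blocks, and the Hessian formula -/

namespace Isospectral

variable {n : ℕ}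

/-- The columns of `U` are an orthonormal basis of eigenvectors of `H`, for the eigenvalues
`lam a`; the `a`-th one is supported on the rows `x` with `c x = l a`. -/
structure IsFrame {κ : Type} (lam : Fin n → ℝ) (c l : Fin n → κ) (H U : Matrix (Fin n) (Fin n) ℝ) :
    Prop where
  orth : Uᵀ * U = 1
  eigen : H * U = U * diagonal lam
  supp : ∀ x a, c x ≠ l a → U x a = 0

theorem dotProduct_eq_zero_of_eigenvectors {H : Matrix (Fin n) (Fin n) ℝ} (hH : H.IsSymm)
    {v w : Fin n → ℝ} {s t : ℝ} (hst : s ≠ t) (hv : H *ᵥ v = s • v) (hw : H *ᵥ w = t • w) :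
    v ⬝ᵥ w = 0 := by
  have h1 : (H *ᵥ v) ⬝ᵥ w = v ⬝ᵥ (H *ᵥ w) := by
    rw [dotProduct_mulVec, ← mulVec_transpose, hH.eq]
  rw [hv, hw, smul_dotProduct, dotProduct_smul, smul_eq_mul, smul_eq_mul] at h1
  have h2 : (s - t) * (v ⬝ᵥ w) = 0 := by linarith
  exact (mul_eq_zero.1 h2).resolve_left (sub_ne_zero.2 hst)

theorem BlockPartition.exists_isFrame (α : BlockPartition n) {lam : Fin n → ℝ}
    (hlam : Function.Injective lam) {σ : Equiv.Perm (Fin n)} {H : Matrix (Fin n) (Fin n) ℝ}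
    (hH : H ∈ α.blockSet lam σ) :
    ∃ U, IsFrame lam (fun x => α.label (σ x)) α.label H U := by
  obtain ⟨h1, -, -, h4⟩ := hH
  choose v hv hs he using h4
  have hpos : ∀ a, 0 < v a ⬝ᵥ v a := fun a =>
    lt_of_le_of_ne (Finset.sum_nonneg fun i _ => mul_self_nonneg _)
      (fun h => hv a (dotProduct_self_eq_zero.1 h.symm))
  refine ⟨of fun x a => v a x / √(v a ⬝ᵥ v a), ?_, ?_, ?_⟩
  · ext a b
    have hab : ((of fun x a => v a x / √(v a ⬝ᵥ v a))ᵀ * of fun x a => v a x / √(v a ⬝ᵥ v a)) a b =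
        (v a ⬝ᵥ v b) / (√(v a ⬝ᵥ v a) * √(v b ⬝ᵥ v b)) := by
      simp only [mul_apply, transpose_apply, of_apply, div_mul_div_comm]
      rw [← Finset.sum_div]; rfl
    rw [hab]
    by_cases h : a = b
    · subst h
      rw [Real.mul_self_sqrt (hpos a).le, div_self (hpos a).ne', one_apply_eq]
    · rw [dotProduct_eq_zero_of_eigenvectors h1 (fun e => h (hlam e)) (he a) (he b), zero_div,
        one_apply_ne h]
  · ext x a
    have := congrFun (he a) x
    simp only [mulVec, dotProduct, Pi.smul_apply, smul_eq_mul] at this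
    rw [mul_diagonal, mul_apply]
    simp only [of_apply, mul_div_assoc']
    rw [← Finset.sum_div, this]
    ring
  · intro x a hx
    simp [hs a x hx]

namespace IsFrame

variable {κ : Type} {lam : Fin n → ℝ} {c l : Fin n → κ} {H U : Matrix (Fin n) (Fin n) ℝ}

theorem orth' (h : IsFrame lam c l H U) : U * Uᵀ = 1 := mul_eq_one_comm.1 h.orth

theorem eigen' (h : IsFrame lam c l H U) : Uᵀ * H = diagonal lam * Uᵀ := by
  calc Uᵀ * H = Uᵀ * (H * U) * Uᵀ := by simp only [Matrix.mul_assoc, h.orth', Matrix.mul_one]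
    _ = diagonal lam * Uᵀ := by
      rw [h.eigen, ← Matrix.mul_assoc, h.orth, Matrix.one_mul]

/-- The bracket with `H`, in the basis of eigenvectors. -/
theorem conj_lie (h : IsFrame lam c l H U) (A : Matrix (Fin n) (Fin n) ℝ) (a b : Fin n) :
    (Uᵀ * ⁅H, A⁆ * U) a b = (lam a - lam b) * (Uᵀ * A * U) a b := by
  have : Uᵀ * ⁅H, A⁆ * U = diagonal lam * (Uᵀ * A * U) - (Uᵀ * A * U) * diagonal lam := by
    rw [Ring.lie_def, Matrix.mul_sub, Matrix.sub_mul, ← Matrix.mul_assoc, h.eigen']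
    simp only [Matrix.mul_assoc, h.eigen]
  rw [this, Matrix.sub_apply, diagonal_mul, mul_diagonal]
  ring

theorem conj_injective (h : IsFrame lam c l H U) {A B : Matrix (Fin n) (Fin n) ℝ}
    (hAB : Uᵀ * A * U = Uᵀ * B * U) : A = B := by
  have := congrArg (fun X => U * X * Uᵀ) hAB
  simpa only [Matrix.mul_assoc, h.orth', Matrix.mul_one, ← Matrix.mul_assoc U Uᵀ, Matrix.one_mul]
    using this

theorem trace_mul (h : IsFrame lam c l H U) (A B : Matrix (Fin n) (Fin n) ℝ) :
    (A * B).trace = ∑ a, ∑ b, (Uᵀ * A * U) a b * (Uᵀ * B * U) b a := by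
  have : ((Uᵀ * A * U) * (Uᵀ * B * U)).trace = (A * B).trace := by
    calc _ = (Uᵀ * (A * (U * Uᵀ) * B) * U).trace := by simp only [Matrix.mul_assoc]
      _ = _ := by
        rw [h.orth', Matrix.mul_one, Matrix.trace_mul_comm, ← Matrix.mul_assoc, h.orth',
          Matrix.one_mul]
  rw [← this]
  simp only [trace, diag_apply, mul_apply (M := Uᵀ * A * U)]

theorem conj_skew {A : Matrix (Fin n) (Fin n) ℝ} (hA : Aᵀ = -A) : (Uᵀ * A * U)ᵀ = -(Uᵀ * A * U) := by
  simp [Matrix.transpose_mul, hA, Matrix.mul_assoc]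

/-- In the eigenbasis the bracket multiplies the entry `a, b` by `λ_a - λ_b`, which is nonzero off
the diagonal, and skew matrices have zero diagonal. This makes the choice in `adInv` harmless. -/
theorem lie_injective (h : IsFrame lam c l H U) (hlam : Function.Injective lam)
    {A B : Matrix (Fin n) (Fin n) ℝ} (hA : Aᵀ = -A) (hB : Bᵀ = -B) (hAB : ⁅H, A⁆ = ⁅H, B⁆) :
    A = B := by
  refine h.conj_injective ?_
  ext a b
  by_cases hab : a = b
  · subst hab
    have hz : ∀ C : Matrix (Fin n) (Fin n) ℝ, Cᵀ = -C → (Uᵀ * C * U) a a = 0 := by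
      intro C hC
      have := congrFun (congrFun (conj_skew (U := U) hC) a) a
      rw [transpose_apply, Matrix.neg_apply] at this
      linarith
    rw [hz A hA, hz B hB]
  · have h1 := h.conj_lie A a b
    rw [hAB, h.conj_lie B a b] at h1
    exact (mul_left_cancel₀ (sub_ne_zero.2 fun e => hab (hlam e)) h1).symm

theorem adInv_lie (h : IsFrame lam c l H U) (hlam : Function.Injective lam)
    {A : Matrix (Fin n) (Fin n) ℝ} (hA : Aᵀ = -A) : adInv H ⁅H, A⁆ = A := by
  have hex : ∃ Ω : Matrix (Fin n) (Fin n) ℝ, Ωᵀ = -Ω ∧ ⁅H, Ω⁆ = ⁅H, A⁆ := ⟨A, hA, rfl⟩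
  rw [adInv, dif_pos hex]
  exact h.lie_injective hlam hex.choose_spec.1 hA hex.choose_spec.2

/-- A matrix supported on the blocks is block diagonal in the basis of eigenvectors. -/
theorem conj_eq_zero (h : IsFrame lam c l H U) {A : Matrix (Fin n) (Fin n) ℝ}
    (hA : ∀ x y, c x ≠ c y → A x y = 0) {a b : Fin n} (hab : l a ≠ l b) :
    (Uᵀ * A * U) a b = 0 := by
  simp only [mul_apply, transpose_apply]
  refine Finset.sum_eq_zero fun y _ => ?_
  by_cases hy : c y = l b
  · rw [Finset.sum_eq_zero, zero_mul]
    intro x _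
    by_cases hx : c x = l a
    · rw [hA x y (by rwa [hx, hy]), mul_zero]
    · rw [h.supp x a hx, zero_mul]
  · rw [h.supp y b hy, mul_zero]

/-- A diagonal matrix that is scalar on each block is diagonal in the basis of eigenvectors. -/
theorem diagonal_blocks (h : IsFrame lam c l H U) (m : κ → ℝ) :
    IsFrame (fun a => m (l a)) c l (diagonal fun x => m (c x)) U := by
  refine ⟨h.orth, ?_, h.supp⟩
  ext x a
  rw [diagonal_mul, mul_diagonal]
  by_cases hx : c x = l a
  · rw [hx, mul_comm]
  · rw [h.supp x a hx, zero_mul, mul_zero]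

/-- If `H` commutes with the projection `diagonal e` onto a set of rows, then this projection is
the sum of the projections onto the eigenvectors of `H` in a set `A`. -/
theorem exists_conj_projection (h : IsFrame lam c l H U) (hlam : Function.Injective lam)
    {e : Fin n → ℝ} (he : ∀ x, e x = 0 ∨ e x = 1) {μ : ℝ} (hμ : ∀ x, e x = 1 → H x x = μ)
    (hH : ∀ x y, e x ≠ e y → H x y = 0) :
    ∃ A : Finset (Fin n), (∀ a, (Uᵀ * diagonal e * U) a a = if a ∈ A then 1 else 0) ∧
      (∀ a b, a ≠ b → (Uᵀ * diagonal e * U) a b = 0) ∧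
      (A.card : ℝ) = ∑ x, e x ∧ ∑ a ∈ A, lam a = μ * A.card := by
  have hlie : ⁅H, diagonal e⁆ = 0 := by
    ext x y
    rw [Ring.lie_def, Matrix.sub_apply, mul_diagonal, diagonal_mul, Matrix.zero_apply]
    by_cases hxy : e x = e y
    · rw [hxy]; ring
    · rw [hH x y hxy]; ring
  have hoff : ∀ a b, a ≠ b → (Uᵀ * diagonal e * U) a b = 0 := by
    intro a b hab
    have h1 := h.conj_lie (diagonal e) a b
    rw [hlie, Matrix.mul_zero, Matrix.zero_mul, Matrix.zero_apply, eq_comm] at h1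
    exact (mul_eq_zero.1 h1).resolve_left (sub_ne_zero.2 fun e => hab (hlam e))
  -- The projection is already diagonal in the eigenbasis; idempotence forces its diagonal entries
  -- to be `0` or `1`.
  have hidem : (Uᵀ * diagonal e * U) * (Uᵀ * diagonal e * U) = Uᵀ * diagonal e * U := by
    calc _ = Uᵀ * (diagonal e * (U * Uᵀ) * diagonal e) * U := by simp only [Matrix.mul_assoc]
      _ = _ := by
        rw [h.orth', Matrix.mul_one, diagonal_mul_diagonal]
        congr 3
        funext x
        rcases he x with hx | hx <;> simp [hx]
  have h01 : ∀ a, (Uᵀ * diagonal e * U) a a = 0 ∨ (Uᵀ * diagonal e * U) a a = 1 := by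
    intro a
    have h1 := congrFun (congrFun hidem a) a
    rw [mul_apply, Finset.sum_eq_single a (fun b _ hb => by rw [hoff b a hb, mul_zero])
      (by simp)] at h1
    rcases eq_or_ne ((Uᵀ * diagonal e * U) a a) 0 with h0 | h0
    · exact Or.inl h0
    · exact Or.inr (mul_left_cancel₀ h0 (by rw [h1, mul_one]))
  have hval : ∀ a, (Uᵀ * diagonal e * U) a a =
      if a ∈ Finset.univ.filter (fun a => (Uᵀ * diagonal e * U) a a = 1) then 1 else 0 := by
    intro a
    rcases h01 a with ha | ha <;> simp [ha]
  have hcard : ((Finset.univ.filter fun a => (Uᵀ * diagonal e * U) a a = 1).card : ℝ) =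
      ∑ x, e x := by
    have h1 : (Uᵀ * diagonal e * U).trace = (diagonal e).trace := by
      rw [Matrix.trace_mul_comm, ← Matrix.mul_assoc, h.orth', Matrix.one_mul]
    rw [trace_diagonal] at h1
    rw [← h1, trace, ← Finset.sum_boole]
    refine Finset.sum_congr rfl fun a _ => ?_
    rw [diag_apply, hval a]
    rcases h01 a with ha | ha <;> simp [ha]
  refine ⟨_, hval, hoff, hcard, ?_⟩
  -- The trace of `H * diagonal e` is `μ` times the rank in the standard basis, and the sum of `λ_a`
  -- over `A` in the eigenbasis.
  have h1 := h.trace_mul H (diagonal e)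
  have h2 : Uᵀ * H * U = diagonal lam := by
    rw [Matrix.mul_assoc, h.eigen, ← Matrix.mul_assoc, h.orth, Matrix.one_mul]
  have h3 : (H * diagonal e).trace = μ * ∑ x, e x := by
    rw [trace, Finset.mul_sum]
    refine Finset.sum_congr rfl fun x _ => ?_
    rw [diag_apply, mul_diagonal]
    rcases he x with hx | hx
    · rw [hx]; ring
    · rw [hμ x hx]
  rw [h3, h2] at h1
  rw [hcard, h1, Finset.sum_filter]
  refine Finset.sum_congr rfl fun a _ => ?_
  rw [Finset.sum_eq_single a (fun b _ hb => by rw [diagonal_apply_ne' _ hb, zero_mul]) (by simp),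
    diagonal_apply_eq]
  rcases h01 a with ha | ha <;> simp [ha]

/-- Strong disjointness makes the blocks irreducible: a diagonal matrix that commutes with `H` is
scalar on each block. -/
theorem eq_of_lie_diagonal_eq_zero (h : IsFrame lam c l H U) (hlam : Function.Injective lam)
    (hdis : StronglyDisjoint lam) {m : κ → ℝ} (hm : ∀ x, H x x = m (c x))
    (hblock : ∀ x y, c x ≠ c y → H x y = 0) {d : Fin n → ℝ} (hd : ⁅H, diagonal d⁆ = 0)
    {z w : Fin n} (hzw : c z = c w) : d z = d w := by
  classical
  by_contra hne
  have hH : ∀ x y, d x ≠ d y → H x y = 0 := by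
    intro x y hxy
    have h1 := congrFun (congrFun hd x) y
    rw [Ring.lie_def, Matrix.sub_apply, mul_diagonal, diagonal_mul, Matrix.zero_apply] at h1
    have h2 : (d x - d y) * H x y = 0 := by linarith
    exact (mul_eq_zero.1 h2).resolve_left (sub_ne_zero.2 hxy)
  -- `d` cuts the block of `z` into the level set of `d z` and the rest. `H` commutes with the
  -- projection onto each piece and has constant diagonal `m (c z)` there, so both pieces carry
  -- eigenvalues of the same mean. The projections have product zero, so the two sets of eigenvalues
  -- are disjoint, against strong disjointness.
  have key : ∀ P : ℝ → Prop, ∀ u, c u = c z → P (d u) →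
      ∃ (e : Fin n → ℝ) (A : Finset (Fin n)), (∀ x, e x = 0 ∨ P (d x)) ∧
      (∀ a, (Uᵀ * diagonal e * U) a a = if a ∈ A then 1 else 0) ∧
      (∀ a b, a ≠ b → (Uᵀ * diagonal e * U) a b = 0) ∧ A.Nonempty ∧ (∑ a ∈ A, lam a) / (A.card : ℝ) = m (c z) := by
    intro P u hu hPu
    obtain ⟨A, h1, h2, h3, h4⟩ := h.exists_conj_projection hlam
      (e := fun x => if c x = c z ∧ P (d x) then (1 : ℝ) else 0) (μ := m (c z))
      (fun x => by by_cases hx : c x = c z ∧ P (d x) <;> simp [hx])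
      (fun x hx => by
        rw [hm]
        by_contra hcx
        have : c x ≠ c z := fun e => hcx (by rw [e])
        simp [this] at hx)
      (fun x y hxy => by
        by_contra hxy'
        have hc : c x = c y := by
          by_contra hc; exact hxy' (hblock x y hc)
        have hd : d x = d y := by
          by_contra hc; exact hxy' (hH x y hc)
        exact hxy (by simp only [hc, hd]))
    have hpos : (0 : ℝ) < A.card := by
      rw [h3]
      refine Finset.sum_pos' (fun x _ => by split_ifs <;> norm_num) ⟨u, Finset.mem_univ _, ?_⟩
      rw [if_pos ⟨hu, hPu⟩]; exact one_pos
    refine ⟨_, A, fun x => ?_, h1, h2, Finset.card_pos.1 (by exact_mod_cast hpos), ?_⟩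
    · by_cases hx : P (d x)
      · exact Or.inr hx
      · simp [hx]
    rw [h4, mul_div_assoc, div_self hpos.ne', mul_one]
  obtain ⟨e, A, he, hA, -, hA0, hAm⟩ := key (fun t => t = d z) z rfl rfl
  obtain ⟨f, B, hf, hB, hB', hB0, hBm⟩ := key (fun t => t ≠ d z) w hzw.symm (Ne.symm hne)
  refine hdis A B hA0 hB0 ?_ (hAm.trans hBm.symm)
  rw [Finset.disjoint_left]
  intro a haA haB
  have hprod : ∀ e f : Fin n → ℝ, (∀ x, e x * f x = 0) →
      (Uᵀ * diagonal e * U) * (Uᵀ * diagonal f * U) = 0 := by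
    intro e f hef
    calc _ = Uᵀ * (diagonal e * (U * Uᵀ) * diagonal f) * U := by simp only [Matrix.mul_assoc]
      _ = 0 := by
        rw [h.orth', Matrix.mul_one, diagonal_mul_diagonal]
        simp [hef]
  have h1 := congrFun (congrFun (hprod e f fun x => by
    rcases he x with hx | hx
    · rw [hx, zero_mul]
    · rw [(hf x).resolve_right fun h' => h' hx, mul_zero]) a) a
  rw [mul_apply, Finset.sum_eq_single a (fun b _ hb => by rw [hB' b a hb, mul_zero])
      (by simp), hA, hB, if_pos haA, if_pos haB] at h1
  norm_num at h1

end IsFrame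

theorem trace_lie_mul (D V B : Matrix (Fin n) (Fin n) ℝ) :
    (⁅D, V⁆ * B).trace = (D * ⁅V, B⁆).trace := by
  rw [Ring.lie_def, Ring.lie_def, Matrix.sub_mul, Matrix.mul_sub, trace_sub, trace_sub,
    Matrix.mul_assoc, Matrix.mul_assoc, Matrix.trace_mul_comm V, Matrix.mul_assoc]

theorem lineDeriv_potential (K X : Matrix (Fin n) (Fin n) ℝ) :
    lineDeriv ℝ potential K X = ∑ i, K i i * X i i := by
  refine HasDerivAt.deriv ?_
  have : ∀ i ∈ Finset.univ, HasDerivAt (fun t : ℝ => (K i i + t * X i i) ^ 2)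
      (2 * (K i i * X i i)) 0 := by
    intro i _
    have h := (((hasDerivAt_id (0 : ℝ)).mul_const (X i i)).const_add (K i i)).pow 2
    refine h.congr_deriv ?_
    simp; ring
  refine ((HasDerivAt.fun_sum this).const_mul (1 / 2 : ℝ)).congr_deriv ?_
  rw [← Finset.mul_sum]; ring

theorem hessian_eq (H V W : Matrix (Fin n) (Fin n) ℝ) :
    hessian H V W = ∑ i, (V i i * ⁅H, adInv H W⁆ i i + H i i * ⁅V, adInv H W⁆ i i) := by
  unfold hessian
  simp only [lineDeriv_potential]
  refine HasDerivAt.deriv ?_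
  refine HasDerivAt.fun_sum fun i _ => ?_
  have h1 := ((hasDerivAt_id (0 : ℝ)).mul_const (V i i)).const_add (H i i)
  have h2 := ((hasDerivAt_id (0 : ℝ)).mul_const (⁅V, adInv H W⁆ i i)).const_add
    (⁅H, adInv H W⁆ i i)
  have h3 := h1.mul h2
  simp only [id, zero_mul, add_zero, one_mul] at h3
  refine h3.congr_of_eventuallyEq (Filter.Eventually.of_forall fun t => ?_)
  have : ⁅H + t • V, adInv H W⁆ = ⁅H, adInv H W⁆ + t • ⁅V, adInv H W⁆ := by
    simp only [Ring.lie_def, add_mul, mul_add, smul_mul_assoc, mul_smul_comm, smul_sub]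
    abel
  simp [this]

namespace IsFrame

variable {κ : Type} {lam : Fin n → ℝ} {c l : Fin n → κ} {H U : Matrix (Fin n) (Fin n) ℝ}

/-- The Hessian in terms of skew symmetric matrices. -/
theorem hessian_lie (h : IsFrame lam c l H U) (hlam : Function.Injective lam)
    {m : κ → ℝ} (hm : ∀ x, H x x = m (c x)) {A B : Matrix (Fin n) (Fin n) ℝ} (hB : Bᵀ = -B) :
    hessian H ⁅H, A⁆ ⁅H, B⁆ = ∑ i, ⁅H, A⁆ i i * ⁅H, B⁆ i i -
      ∑ a, ∑ b, (m (l a) - m (l b)) * (lam a - lam b) *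
        ((Uᵀ * A * U) a b * (Uᵀ * B * U) a b) := by
  rw [hessian_eq, h.adInv_lie hlam hB, Finset.sum_add_distrib, sub_eq_add_neg]
  congr 1
  -- The diagonal part of `H` is scalar on each block, hence diagonal in the eigenbasis too. Moving
  -- the bracket onto it by invariance of the trace yields the factor `(m_a - m_b)(λ_a - λ_b)`; the
  -- sign comes from the skewness of `B`.
  have h1 : ∑ i, H i i * ⁅⁅H, A⁆, B⁆ i i =
      (⁅diagonal fun x => m (c x), ⁅H, A⁆⁆ * B).trace := by
    rw [trace_lie_mul, trace]
    exact Finset.sum_congr rfl fun i _ => by rw [diag_apply, diagonal_mul, hm]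
  rw [h1, h.trace_mul, ← Finset.sum_neg_distrib]
  refine Finset.sum_congr rfl fun a _ => ?_
  rw [← Finset.sum_neg_distrib]
  refine Finset.sum_congr rfl fun b _ => ?_
  have h3 := congrFun (congrFun (conj_skew (U := U) hB) a) b
  rw [transpose_apply, Matrix.neg_apply] at h3
  rw [(h.diagonal_blocks m).conj_lie, h.conj_lie, h3]
  ring

theorem normalMetric_lie (h : IsFrame lam c l H U) (hlam : Function.Injective lam)
    {A B : Matrix (Fin n) (Fin n) ℝ} (hA : Aᵀ = -A) (hB : Bᵀ = -B) :
    normalMetric H ⁅H, A⁆ ⁅H, B⁆ = ∑ x, ∑ y, A x y * B x y := by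
  rw [normalMetric, h.adInv_lie hlam hA, h.adInv_lie hlam hB, trace, ← Finset.sum_neg_distrib]
  refine Finset.sum_congr rfl fun x _ => ?_
  rw [diag_apply, mul_apply, ← Finset.sum_neg_distrib]
  refine Finset.sum_congr rfl fun y _ => ?_
  have := congrFun (congrFun hB x) y
  rw [transpose_apply, Matrix.neg_apply] at this
  rw [this]; ring

end IsFrame

end Isospectral

/-! ### Planes of positivity and the number of positive eigenvalues -/

namespace Isospectral

/-- A symmetric bilinear form that is positive definite on a plane has at least two positive
eigenvalues. -/
theorem one_lt_finrank_of_posDef_plane {E : Type*} [NormedAddCommGroup E] [InnerProductSpace ℝ E]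
    [FiniteDimensional ℝ E] (B : E →ₗ[ℝ] E →ₗ[ℝ] ℝ) (hB : ∀ x y, B x y = B y x)
    (P : Submodule ℝ E)
    (hP : ∀ x : E, ∀ r : ℝ, 0 < r → (∀ y, B x y = r * inner ℝ x y) → x ∈ P)
    {x₁ x₂ : E} (hpos : ∀ s t : ℝ, (s ≠ 0 ∨ t ≠ 0) →
      0 < B (s • x₁ + t • x₂) (s • x₁ + t • x₂)) :
    1 < Module.finrank ℝ P := by
  let b := stdOrthonormalBasis ℝ E
  let T : E →ₗ[ℝ] E := ∑ i, (B.flip (b i)).smulRight (b i)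
  have hT : ∀ x y, inner ℝ (T x) y = B x y := by
    intro x y
    conv_rhs => rw [← b.sum_repr' y]
    simp only [T, LinearMap.sum_apply, LinearMap.smulRight_apply, LinearMap.flip_apply, sum_inner,
      inner_smul_left, map_sum, map_smul, smul_eq_mul]
    exact Finset.sum_congr rfl fun i _ => by simp [mul_comm]
  have hsym : T.IsSymmetric := fun x y => by
    rw [hT, hB, ← hT, real_inner_comm]
  let e := hsym.eigenvectorBasis rfl
  have he : ∀ i y, B (e i) y = hsym.eigenvalues rfl i * inner ℝ (e i) y := by
    intro i y
    rw [← hT, hsym.apply_eigenvectorBasis rfl i, inner_smul_left]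
    simp [e]
  by_contra hlt
  have huniq : ∀ i j, 0 < hsym.eigenvalues rfl i → 0 < hsym.eigenvalues rfl j → i = j := by
    intro i j hi hj
    by_contra hij
    have hli : LinearIndependent ℝ ![(⟨e i, hP _ _ hi (he i)⟩ : P), ⟨e j, hP _ _ hj (he j)⟩] := by
      refine LinearIndependent.of_comp P.subtype ?_
      have h1 := e.orthonormal.linearIndependent.comp ![i, j] (by
        intro x y hxy
        fin_cases x <;> fin_cases y <;> simp_all)
      have heq : P.subtype ∘ ![(⟨e i, hP _ _ hi (he i)⟩ : P), ⟨e j, hP _ _ hj (he j)⟩] =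
          e ∘ ![i, j] := by
        funext x
        fin_cases x <;> rfl
      rw [heq]
      exact h1
    have := hli.fintype_card_le_finrank
    simp at this
    omega
  have hquad : ∀ x, B x x = ∑ i, hsym.eigenvalues rfl i * (inner ℝ (e i) x) ^ 2 := by
    intro x
    have h1 := congrArg (B x) (e.sum_repr' x)
    rw [← h1, map_sum]
    refine Finset.sum_congr rfl fun i _ => ?_
    rw [map_smul, hB, he, smul_eq_mul]
    ring
  -- With at most one positive eigenvalue, the form is nonpositive on the kernel of a single
  -- functional, and every plane meets that kernel.
  have hf : ∃ f : E →ₗ[ℝ] ℝ, ∀ x, f x = 0 → B x x ≤ 0 := by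
    by_cases hex : ∃ i, 0 < hsym.eigenvalues rfl i
    · obtain ⟨i, hi⟩ := hex
      refine ⟨(innerSL ℝ (e i)).toLinearMap, fun x hx => ?_⟩
      rw [hquad]
      refine Finset.sum_nonpos fun j _ => ?_
      by_cases hj : j = i
      · subst hj
        have : inner ℝ (e j) x = 0 := hx
        rw [this]; simp
      · exact mul_nonpos_of_nonpos_of_nonneg
          (not_lt.1 fun h => hj (huniq _ _ h hi)) (sq_nonneg _)
    · push Not at hex
      refine ⟨0, fun x _ => ?_⟩
      rw [hquad]
      exact Finset.sum_nonpos fun j _ => mul_nonpos_of_nonpos_of_nonneg (hex j) (sq_nonneg _)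
  obtain ⟨f, hf⟩ := hf
  by_cases h0 : f x₁ = 0
  · exact (hf ((1 : ℝ) • x₁ + (0 : ℝ) • x₂) (by simp [h0])).not_gt (hpos 1 0 (by simp))
  · refine (hf (f x₂ • x₁ + (-f x₁) • x₂) ?_).not_gt (hpos _ _ (Or.inr (neg_ne_zero.2 h0)))
    simp only [map_add, map_smul, smul_eq_mul]
    ring

/-- The same with the inner product given as a bilinear form. -/
theorem one_lt_finrank_of_posDef_plane_bilin {V : Type*} [AddCommGroup V] [Module ℝ V]
    [FiniteDimensional ℝ V] (g B : V →ₗ[ℝ] V →ₗ[ℝ] ℝ) (hg : ∀ x y, g x y = g y x)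
    (hg0 : ∀ x, 0 ≤ g x x) (hg1 : ∀ x, g x x = 0 → x = 0) (hB : ∀ x y, B x y = B y x)
    (P : Submodule ℝ V) (hP : ∀ x : V, ∀ r : ℝ, 0 < r → (∀ y, B x y = r * g x y) → x ∈ P)
    {x₁ x₂ : V} (hpos : ∀ s t : ℝ, (s ≠ 0 ∨ t ≠ 0) →
      0 < B (s • x₁ + t • x₂) (s • x₁ + t • x₂)) :
    1 < Module.finrank ℝ P := by
  let core : InnerProductSpace.Core ℝ V :=
    { inner := fun x y => g x y
      conj_inner_symm := fun x y => by simpa using hg y x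
      re_inner_nonneg := fun x => by simpa using hg0 x
      add_left := fun x y z => by simp
      smul_left := fun x y r => by simp
      definite := fun x h => hg1 x h }
  let _ : NormedAddCommGroup V := core.toNormedAddCommGroup
  let _ : InnerProductSpace ℝ V := InnerProductSpace.ofCore core.toCore
  exact one_lt_finrank_of_posDef_plane B hB P hP hpos

variable {n : ℕ} {κ : Type} {lam : Fin n → ℝ} {c l : Fin n → κ} {H U : Matrix (Fin n) (Fin n) ℝ}

theorem eq_zero_of_sum_mul_self_eq_zero {A : Matrix (Fin n) (Fin n) ℝ}
    (hA : ∑ x, ∑ y, A x y * A x y = 0) : A = 0 := by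
  ext x y
  have h1 := (Finset.sum_eq_zero_iff_of_nonneg fun x _ =>
    Finset.sum_nonneg fun y _ => mul_self_nonneg (A x y)).1 hA x (Finset.mem_univ _)
  have h2 := (Finset.sum_eq_zero_iff_of_nonneg fun y _ => mul_self_nonneg (A x y)).1 h1 y
    (Finset.mem_univ _)
  exact mul_self_eq_zero.1 h2

/-- If the Hessian is positive definite on a plane in the normal space, the co-index is at
least `2`. -/
theorem IsFrame.one_lt_coindexAt (h : IsFrame lam c l H U) (hlam : Function.Injective lam)
    {m : κ → ℝ} (hm : ∀ x, H x x = m (c x)) (M : Set (Matrix (Fin n) (Fin n) ℝ))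
    {A B : Matrix (Fin n) (Fin n) ℝ}
    (hAM : ⁅H, A⁆ ∈ normalSpace M H) (hBM : ⁅H, B⁆ ∈ normalSpace M H)
    (hpos : ∀ s t : ℝ, (s ≠ 0 ∨ t ≠ 0) →
      0 < hessian H ⁅H, s • A + t • B⁆ ⁅H, s • A + t • B⁆) :
    1 < coindexAt M H := by
  have had : ∀ {V}, V ∈ tangent H → (adInv H V)ᵀ = -adInv H V ∧ ⁅H, adInv H V⁆ = V := by
    intro V hV
    have hV' : ∃ Ω : Matrix (Fin n) (Fin n) ℝ, Ωᵀ = -Ω ∧ ⁅H, Ω⁆ = V := hV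
    rw [adInv, dif_pos hV']
    exact hV'.choose_spec
  have hskew : ∀ {A B : Matrix (Fin n) (Fin n) ℝ}, Aᵀ = -A → Bᵀ = -B → ∀ s t : ℝ,
      (s • A + t • B)ᵀ = -(s • A + t • B) := by
    intro A B hA hB s t
    rw [transpose_add, transpose_smul, transpose_smul, hA, hB, smul_neg, smul_neg, neg_add]
  have hlie : ∀ (A B : Matrix (Fin n) (Fin n) ℝ) (s t : ℝ),
      ⁅H, s • A + t • B⁆ = s • ⁅H, A⁆ + t • ⁅H, B⁆ := by
    intro A B s t
    simp only [Ring.lie_def, add_mul, mul_add, smul_mul_assoc, mul_smul_comm, smul_sub]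
    abel
  have htan : ∀ {V W}, V ∈ tangent H → W ∈ tangent H → ∀ s t : ℝ,
      s • V + t • W ∈ tangent H ∧ adInv H (s • V + t • W) = s • adInv H V + t • adInv H W := by
    intro V W hV hW s t
    have h1 : ⁅H, s • adInv H V + t • adInv H W⁆ = s • V + t • W := by
      rw [hlie, (had hV).2, (had hW).2]
    have h2 := hskew (had hV).1 (had hW).1 s t
    refine ⟨⟨_, h2, h1⟩, ?_⟩
    rw [← h1, h.adInv_lie hlam h2]
  have hgl : ∀ {V W}, V ∈ tangent H → W ∈ tangent H → ∀ (s t : ℝ) X,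
      normalMetric H (s • V + t • W) X = s * normalMetric H V X + t * normalMetric H W X := by
    intro V W hV hW s t X
    simp only [normalMetric, (htan hV hW s t).2, Matrix.add_mul, smul_mul_assoc, trace_add,
      trace_smul, smul_eq_mul]
    ring
  have hgc : ∀ V W, normalMetric H V W = normalMetric H W V := by
    intro V W
    rw [normalMetric, Matrix.trace_mul_comm]; rfl
  have hQl : ∀ (V W) (s t : ℝ) X,
      hessian H (s • V + t • W) X = s * hessian H V X + t * hessian H W X := by
    intro V W s t X
    simp only [hessian_eq, Finset.mul_sum, ← Finset.sum_add_distrib]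
    refine Finset.sum_congr rfl fun i _ => ?_
    have : ⁅s • V + t • W, adInv H X⁆ = s • ⁅V, adInv H X⁆ + t • ⁅W, adInv H X⁆ := by
      simp only [Ring.lie_def, add_mul, mul_add, smul_mul_assoc, mul_smul_comm, smul_sub]
      abel
    rw [this]
    simp only [Matrix.add_apply, Matrix.smul_apply, smul_eq_mul]
    ring
  -- Linearity of `hessian` in its second argument holds only where `adInv` is not a default value,
  -- so it is deduced from symmetry on tangent vectors.
  have hQc : ∀ {V W}, V ∈ tangent H → W ∈ tangent H → hessian H V W = hessian H W V := by
    rintro _ _ ⟨A, hA, rfl⟩ ⟨B, hB, rfl⟩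
    rw [h.hessian_lie hlam hm hB, h.hessian_lie hlam hm hA]
    congr 1
    · exact Finset.sum_congr rfl fun i _ => mul_comm _ _
    · exact Finset.sum_congr rfl fun a _ => Finset.sum_congr rfl fun b _ => by ring
  let N : Submodule ℝ (Matrix (Fin n) (Fin n) ℝ) :=
    { carrier := normalSpace M H
      zero_mem' := by
        have h0 : (0 : Matrix (Fin n) (Fin n) ℝ) ∈ tangent H := ⟨0, by simp, by simp [Ring.lie_def]⟩
        refine ⟨h0, fun W _ => ?_⟩
        simpa using hgl h0 h0 0 0 W
      add_mem' := by
        intro V W hV hW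
        refine ⟨by simpa using (htan hV.1 hW.1 1 1).1, fun X hX => ?_⟩
        have := hgl hV.1 hW.1 1 1 X
        rw [hV.2 X hX, hW.2 X hX] at this
        simpa using this
      smul_mem' := by
        intro s V hV
        refine ⟨by simpa using (htan hV.1 hV.1 s 0).1, fun X hX => ?_⟩
        have := hgl hV.1 hV.1 s 0 X
        rw [hV.2 X hX] at this
        simpa using this }
  let g : N →ₗ[ℝ] N →ₗ[ℝ] ℝ := LinearMap.mk₂ ℝ (fun V W => normalMetric H V W)
    (fun V W X => by simpa using hgl V.2.1 W.2.1 1 1 X)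
    (fun s V X => by simpa using hgl V.2.1 V.2.1 s 0 X)
    (fun X V W => by
      rw [hgc X, hgc X, hgc X]
      simpa using hgl V.2.1 W.2.1 1 1 X)
    (fun s X V => by
      rw [hgc X, hgc X]
      simpa using hgl V.2.1 V.2.1 s 0 X)
  let Q : N →ₗ[ℝ] N →ₗ[ℝ] ℝ := LinearMap.mk₂ ℝ (fun V W => hessian H V W)
    (fun V W X => by simpa using hQl V W 1 1 X)
    (fun s V X => by simpa using hQl V V s 0 X)
    (fun X V W => by
      rw [hQc X.2.1 (V + W).2.1, hQc X.2.1 V.2.1, hQc X.2.1 W.2.1]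
      simpa using hQl V W 1 1 X)
    (fun s X V => by
      rw [hQc X.2.1 (s • V).2.1, hQc X.2.1 V.2.1]
      simpa using hQl V V s 0 X)
  have hsq : ∀ V : N, g V V = ∑ x, ∑ y, adInv H V x y * adInv H V x y := by
    intro V
    have h1 := h.normalMetric_lie hlam (had V.2.1).1 (had V.2.1).1
    rw [(had V.2.1).2] at h1
    exact h1
  let S := Submodule.span ℝ (⋃ r ∈ Set.Ioi (0 : ℝ), hessianEigenvectors M H r)
  have hmain : 1 < Module.finrank ℝ (S.comap N.subtype) := by
    refine one_lt_finrank_of_posDef_plane_bilin g Q (fun V W => hgc _ _) (fun V => ?_) (fun V hV => ?_)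
      (fun V W => hQc V.2.1 W.2.1) _ (fun V r hr hV => ?_) (x₁ := ⟨_, hAM⟩) (x₂ := ⟨_, hBM⟩) ?_
    · rw [hsq]
      exact Finset.sum_nonneg fun x _ => Finset.sum_nonneg fun y _ => mul_self_nonneg _
    · rw [hsq] at hV
      have h0 := eq_zero_of_sum_mul_self_eq_zero hV
      refine Subtype.ext ?_
      rw [← (had V.2.1).2, h0]
      simp [Ring.lie_def]
    · refine Submodule.subset_span ?_
      simp only [Set.mem_iUnion]
      exact ⟨r, hr, V.2, fun W hW => hV ⟨W, hW⟩⟩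
    · intro s t hst
      have := hpos s t hst
      rw [hlie] at this
      exact this
  refine hmain.trans_le ?_
  exact LinearMap.finrank_le_finrank_of_injective
    (f := (N.subtype.restrict (p := S.comap N.subtype) (q := S) fun x hx => hx))
    (fun x y hxy => Subtype.ext (Subtype.ext (by
      have h1 := congrArg Subtype.val hxy
      exact h1)))

end Isospectral

/-! ### Normal directions on which the Hessian is positive -/

namespace Isospectral

variable {n : ℕ} {κ : Type} {lam : Fin n → ℝ} {c l : Fin n → κ} {H U : Matrix (Fin n) (Fin n) ℝ}

/-- `adInv` takes its default value `0` here. Hence velocities of `M` need not be shown tangent to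
the isospectral manifold. -/
theorem normalMetric_eq_zero_of_notMem_tangent {V W : Matrix (Fin n) (Fin n) ℝ}
    (hW : W ∉ tangent H) : normalMetric H V W = 0 := by
  have hW' : ¬∃ Ω : Matrix (Fin n) (Fin n) ℝ, Ωᵀ = -Ω ∧ ⁅H, Ω⁆ = W := hW
  rw [normalMetric, adInv.eq_def H W, dif_neg hW', Matrix.mul_zero, trace_zero, neg_zero]

/-- An entry that is constant on `M` does not vary along `M`. -/
theorem velocities_apply_eq_zero {M : Set (Matrix (Fin n) (Fin n) ℝ)}
    {W : Matrix (Fin n) (Fin n) ℝ} (hW : W ∈ velocities M H) {x y : Fin n} {r : ℝ}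
    (hM : ∀ K ∈ M, K x y = r) : W x y = 0 := by
  obtain ⟨γ, -, hγ, -, hd⟩ := hW
  have h1 := hd x y
  have h2 : (fun t => γ t x y) = fun _ => r := funext fun t => hM _ (hγ t)
  rw [h2] at h1
  exact h1.unique (hasDerivAt_const _ _)

theorem lie_apply_self (A : Matrix (Fin n) (Fin n) ℝ) (x : Fin n) :
    ⁅H, A⁆ x x = ∑ y, (H x y * A y x - A x y * H y x) := by
  rw [Ring.lie_def, Matrix.sub_apply, mul_apply, mul_apply, Finset.sum_sub_distrib]

theorem lie_diagonal_apply (d : Fin n → ℝ) (x y : Fin n) :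
    ⁅diagonal d, H⁆ x y = (d x - d y) * H x y := by
  rw [Ring.lie_def, Matrix.sub_apply, diagonal_mul, mul_diagonal]
  ring

theorem lie_diagonal_skew (hH : H.IsSymm) (d : Fin n → ℝ) :
    ⁅diagonal d, H⁆ᵀ = -⁅diagonal d, H⁆ := by
  ext x y
  rw [transpose_apply, Matrix.neg_apply, lie_diagonal_apply, lie_diagonal_apply, hH.apply x y]
  ring

/-- If the Hessian is negative semidefinite on the tangent space, the co-index vanishes. -/
theorem IsFrame.coindexAt_eq_zero (h : IsFrame lam c l H U) (hlam : Function.Injective lam)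
    (M : Set (Matrix (Fin n) (Fin n) ℝ))
    (hneg : ∀ A : Matrix (Fin n) (Fin n) ℝ, Aᵀ = -A → hessian H ⁅H, A⁆ ⁅H, A⁆ ≤ 0) :
    coindexAt M H = 0 := by
  have : Submodule.span ℝ (⋃ r ∈ Set.Ioi (0 : ℝ), hessianEigenvectors M H r) = ⊥ := by
    rw [Submodule.span_eq_bot]
    intro V hV
    simp only [Set.mem_iUnion] at hV
    obtain ⟨r, hr, hVN, hV⟩ := hV
    obtain ⟨A, hA, rfl⟩ := hVN.1
    have h1 := hV _ hVN
    have h2 := hneg A hA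
    rw [h1, h.normalMetric_lie hlam hA hA] at h2
    have h3 : ∑ x, ∑ y, A x y * A x y = 0 :=
      le_antisymm (nonpos_of_mul_nonpos_right h2 hr)
        (Finset.sum_nonneg fun x _ => Finset.sum_nonneg fun y _ => mul_self_nonneg _)
    rw [eq_zero_of_sum_mul_self_eq_zero h3]
    simp [Ring.lie_def]
  rw [coindexAt, this, finrank_bot]

namespace IsFrame

/-- All that matters about a velocity is that its entries off the blocks and on the diagonal vanish,
those entries being constant on `M`. No manifold structure on `M` is needed. -/
theorem mem_normalSpace (h : IsFrame lam c l H U) (hlam : Function.Injective lam) {m : κ → ℝ}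
    {M : Set (Matrix (Fin n) (Fin n) ℝ)}
    (hM : ∀ K ∈ M, (∀ x y, c x ≠ c y → K x y = 0) ∧ ∀ x, K x x = m (c x))
    {A : Matrix (Fin n) (Fin n) ℝ} (hA : Aᵀ = -A)
    (hAM : ∀ B : Matrix (Fin n) (Fin n) ℝ, Bᵀ = -B → (∀ x y, c x ≠ c y → ⁅H, B⁆ x y = 0) →
      (∀ x, ⁅H, B⁆ x x = 0) → (A * B).trace = 0) : ⁅H, A⁆ ∈ normalSpace M H := by
  refine ⟨⟨A, hA, rfl⟩, fun W hW => ?_⟩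
  by_cases ht : W ∈ tangent H
  · obtain ⟨B, hB, rfl⟩ := ht
    rw [normalMetric, h.adInv_lie hlam hA, h.adInv_lie hlam hB, neg_eq_zero]
    exact hAM B hB (fun x y hxy => velocities_apply_eq_zero hW fun K hK => (hM K hK).1 x y hxy)
      (fun x => velocities_apply_eq_zero hW fun K hK => (hM K hK).2 x)
  · exact normalMetric_eq_zero_of_notMem_tangent ht

/-- By invariance, `tr([D, H] B) = tr(D [H, B])`, which involves only the diagonal of `[H, B]`; for
a velocity this is zero. -/
theorem lie_diagonal_mem_normalSpace (h : IsFrame lam c l H U) (hlam : Function.Injective lam)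
    (hH : H.IsSymm) {m : κ → ℝ} {M : Set (Matrix (Fin n) (Fin n) ℝ)}
    (hM : ∀ K ∈ M, (∀ x y, c x ≠ c y → K x y = 0) ∧ ∀ x, K x x = m (c x)) (d : Fin n → ℝ) :
    ⁅H, ⁅diagonal d, H⁆⁆ ∈ normalSpace M H := by
  refine h.mem_normalSpace hlam hM (lie_diagonal_skew hH d) fun B _ _ hB => ?_
  rw [trace_lie_mul, trace]
  exact Finset.sum_eq_zero fun x _ => by rw [diag_apply, diagonal_mul, hB, mul_zero]

/-- If the diagonal of `[H, [D, H]]` vanished, the squared norm of `[D, H]`, equal to `-tr(D [H, [D,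
H]])`, would vanish; then `D` commutes with `H` and is scalar on the blocks. -/
theorem sum_lie_lie_diagonal_pos (h : IsFrame lam c l H U) (hlam : Function.Injective lam)
    (hdis : StronglyDisjoint lam) (hH : H.IsSymm) {m : κ → ℝ} (hm : ∀ x, H x x = m (c x))
    (hblock : ∀ x y, c x ≠ c y → H x y = 0) {d : Fin n → ℝ} {z w : Fin n} (hzw : c z = c w)
    (hd : d z ≠ d w) : 0 < ∑ x, ⁅H, ⁅diagonal d, H⁆⁆ x x * ⁅H, ⁅diagonal d, H⁆⁆ x x := by
  refine lt_of_le_of_ne (Finset.sum_nonneg fun x _ => mul_self_nonneg _) fun h0 => hd ?_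
  have h1 : ∀ x, ⁅H, ⁅diagonal d, H⁆⁆ x x = 0 := fun x =>
    mul_self_eq_zero.1 ((Finset.sum_eq_zero_iff_of_nonneg fun x _ => mul_self_nonneg _).1 h0.symm x
      (Finset.mem_univ _))
  have hs := lie_diagonal_skew hH d
  have h2 : ∑ x, ∑ y, ⁅diagonal d, H⁆ x y * ⁅diagonal d, H⁆ x y = 0 := by
    rw [← h.normalMetric_lie hlam hs hs, normalMetric, h.adInv_lie hlam hs, trace_lie_mul, trace,
      neg_eq_zero]
    exact Finset.sum_eq_zero fun x _ => by rw [diag_apply, diagonal_mul, h1, mul_zero]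
  have h3 := eq_zero_of_sum_mul_self_eq_zero h2
  refine h.eq_of_lie_diagonal_eq_zero hlam hdis hm hblock ?_ hzw
  rw [Ring.lie_def, ← neg_sub, ← Ring.lie_def, h3, neg_zero]

/-- The rotation in the plane of two eigenvectors. -/
theorem exists_rotation (h : IsFrame lam c l H U) {a b : Fin n} :
    ∃ R : Matrix (Fin n) (Fin n) ℝ, Rᵀ = -R ∧
      Uᵀ * R * U = single a b 1 - single b a 1 := by
  refine ⟨U * (single a b 1 - single b a 1) * Uᵀ, ?_, ?_⟩
  · simp only [transpose_mul, transpose_transpose, transpose_sub, transpose_single,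
      ← Matrix.mul_assoc]
    rw [← neg_sub, Matrix.mul_neg, Matrix.neg_mul]
  · simp only [Matrix.mul_assoc, h.orth, Matrix.mul_one]
    rw [← Matrix.mul_assoc, h.orth, Matrix.one_mul]

/-- In the eigenbasis, a `B` whose bracket `[H, B]` is supported on the blocks is itself block
diagonal, while the rotation lives off the blocks, so the trace of their product vanishes. -/
theorem lie_rotation_mem_normalSpace (h : IsFrame lam c l H U) (hlam : Function.Injective lam)
    {m : κ → ℝ} {M : Set (Matrix (Fin n) (Fin n) ℝ)}
    (hM : ∀ K ∈ M, (∀ x y, c x ≠ c y → K x y = 0) ∧ ∀ x, K x x = m (c x)) {a b : Fin n}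
    (hab : l a ≠ l b) {R : Matrix (Fin n) (Fin n) ℝ} (hR : Rᵀ = -R)
    (hRU : Uᵀ * R * U = single a b 1 - single b a 1) : ⁅H, R⁆ ∈ normalSpace M H := by
  refine h.mem_normalSpace hlam hM hR fun B _ hB _ => ?_
  have hzero : ∀ a b, l a ≠ l b → (Uᵀ * B * U) a b = 0 := by
    intro a b hab
    have h1 := h.conj_lie B a b
    rw [h.conj_eq_zero hB hab, eq_comm] at h1
    exact (mul_eq_zero.1 h1).resolve_left
      (sub_ne_zero.2 fun e => hab (congrArg l (hlam e)))
  rw [h.trace_mul, hRU]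
  refine Finset.sum_eq_zero fun x _ => Finset.sum_eq_zero fun y _ => ?_
  by_cases hxy : l y = l x
  · have h1 : ¬(a = x ∧ b = y) := by rintro ⟨rfl, rfl⟩; exact hab hxy.symm
    have h2 : ¬(b = x ∧ a = y) := by rintro ⟨rfl, rfl⟩; exact hab hxy
    rw [Matrix.sub_apply, single_apply_of_ne _ _ _ _ _ h1, single_apply_of_ne _ _ _ _ _ h2,
      sub_zero, zero_mul]
  · rw [hzero y x hxy, mul_zero]

/-- Two independent directions inside the blocks make the co-index at least `2`. -/
theorem one_lt_coindexAt_of_diagonal (h : IsFrame lam c l H U) (hlam : Function.Injective lam)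
    (hdis : StronglyDisjoint lam) (hH : H.IsSymm) {m : κ → ℝ} (hm : ∀ x, H x x = m (c x))
    (hblock : ∀ x y, c x ≠ c y → H x y = 0) {M : Set (Matrix (Fin n) (Fin n) ℝ)}
    (hM : ∀ K ∈ M, (∀ x y, c x ≠ c y → K x y = 0) ∧ ∀ x, K x x = m (c x)) {d e : Fin n → ℝ}
    (hde : ∀ s t : ℝ, (s ≠ 0 ∨ t ≠ 0) →
      ∃ z w, c z = c w ∧ s * d z + t * e z ≠ s * d w + t * e w) : 1 < coindexAt M H := by
  refine h.one_lt_coindexAt hlam hm M (h.lie_diagonal_mem_normalSpace hlam hH hM d)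
    (h.lie_diagonal_mem_normalSpace hlam hH hM e) fun s t hst => ?_
  have h1 : s • ⁅diagonal d, H⁆ + t • ⁅diagonal e, H⁆ =
      ⁅diagonal (fun x => s * d x + t * e x), H⁆ := by
    ext x y
    simp only [Matrix.add_apply, Matrix.smul_apply, lie_diagonal_apply, smul_eq_mul]
    ring
  obtain ⟨z, w, hzw, hne⟩ := hde s t hst
  have h2 := h.sum_lie_lie_diagonal_pos hlam hdis hH hm hblock (d := fun x => s * d x + t * e x) hzw hne
  -- `[D, H]` is supported on the blocks, so in the eigenbasis its entries between different blocks
  -- vanish and only the squares of diagonal entries survive.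
  rw [h1, h.hessian_lie hlam hm (lie_diagonal_skew hH _), Finset.sum_eq_zero (fun a _ =>
    Finset.sum_eq_zero fun b _ => ?_), sub_zero]
  · exact h2
  · by_cases hab : l a = l b
    · rw [hab]; ring
    · rw [h.conj_eq_zero (fun x y hxy => ?_) hab]
      · ring
      · rw [lie_diagonal_apply, hblock x y hxy, mul_zero]

/-- A direction inside a block and an inversion make the co-index at least `2`. -/
theorem one_lt_coindexAt_of_inversion (h : IsFrame lam c l H U) (hlam : Function.Injective lam)
    (hdis : StronglyDisjoint lam) (hH : H.IsSymm) {m : κ → ℝ} (hm : ∀ x, H x x = m (c x))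
    (hblock : ∀ x y, c x ≠ c y → H x y = 0) {M : Set (Matrix (Fin n) (Fin n) ℝ)}
    (hM : ∀ K ∈ M, (∀ x y, c x ≠ c y → K x y = 0) ∧ ∀ x, K x x = m (c x)) {d : Fin n → ℝ}
    {z w : Fin n} (hzw : c z = c w) (hd : d z ≠ d w) {a b : Fin n} (hlt : lam a < lam b)
    (hmlt : m (l b) < m (l a)) : 1 < coindexAt M H := by
  have hab : l a ≠ l b := fun e => by rw [e] at hmlt; exact lt_irrefl _ hmlt
  have hab' : a ≠ b := fun e => hab (congrArg l e)
  obtain ⟨R, hR, hRU⟩ := h.exists_rotation (a := a) (b := b)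
  refine h.one_lt_coindexAt hlam hm M
    (h.lie_diagonal_mem_normalSpace hlam hH hM d)
    (h.lie_rotation_mem_normalSpace hlam hM hab hR hRU) fun s t hst => ?_
  have hD := lie_diagonal_skew hH d
  have hS : (s • ⁅diagonal d, H⁆ + t • R)ᵀ =
      -(s • ⁅diagonal d, H⁆ + t • R) := by
    rw [transpose_add, transpose_smul, transpose_smul, hD, hR, smul_neg, smul_neg, neg_add]
  -- The factor `m - m` kills entries inside a block, and `[D, H]` has none between blocks; so this
  -- sum sees only the rotation.
  have hconj : ∀ x y, (m (l x) - m (l y)) * (lam x - lam y) *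
      ((Uᵀ * (s • ⁅diagonal d, H⁆ + t • R) * U) x y *
        (Uᵀ * (s • ⁅diagonal d, H⁆ + t • R) * U) x y) =
      (m (l x) - m (l y)) * (lam x - lam y) *
        ((t * (single a b (1 : ℝ) - single b a 1 : Matrix _ _ ℝ) x y) ^ 2) := by
    intro x y
    by_cases hxy : l x = l y
    · rw [hxy]; ring
    · have h1 : (Uᵀ * (s • ⁅diagonal d, H⁆ + t • R) * U) =
          s • (Uᵀ * ⁅diagonal d, H⁆ * U) + t • (Uᵀ * R * U) := by
        simp only [Matrix.mul_add, Matrix.add_mul, mul_smul_comm, smul_mul_assoc]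
      rw [h1, hRU, Matrix.add_apply, Matrix.smul_apply, h.conj_eq_zero (fun x y hxy => ?_) hxy,
        Matrix.smul_apply, smul_zero, zero_add, smul_eq_mul]
      · ring
      · rw [lie_diagonal_apply, hblock x y hxy, mul_zero]
  have hterm : ∀ x y, (m (l x) - m (l y)) * (lam x - lam y) *
      ((t * (single a b (1 : ℝ) - single b a 1 : Matrix _ _ ℝ) x y) ^ 2) ≤ 0 := by
    intro x y
    have hprod : (m (l a) - m (l b)) * (lam a - lam b) ≤ 0 :=
      mul_nonpos_of_nonneg_of_nonpos (by linarith) (by linarith)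
    by_cases h1 : a = x ∧ b = y
    · obtain ⟨rfl, rfl⟩ := h1
      exact mul_nonpos_of_nonpos_of_nonneg hprod (sq_nonneg _)
    · by_cases h2 : b = x ∧ a = y
      · obtain ⟨rfl, rfl⟩ := h2
        exact mul_nonpos_of_nonpos_of_nonneg (by linarith) (sq_nonneg _)
      · rw [Matrix.sub_apply, single_apply_of_ne _ _ _ _ _ h1, single_apply_of_ne _ _ _ _ _ h2]
        simp
  rw [h.hessian_lie hlam hm hS]
  simp only [hconj]
  -- For `t ≠ 0` the inversion already gives strict positivity; for `t = 0` it comes from the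
  -- diagonal squares.
  by_cases ht : t = 0
  · have hs : s ≠ 0 := hst.resolve_right (not_not.2 ht)
    have h1 : s • ⁅diagonal d, H⁆ + t • R =
        ⁅diagonal (fun x => s * d x), H⁆ := by
      ext x y
      rw [ht, zero_smul, add_zero, Matrix.smul_apply, lie_diagonal_apply, lie_diagonal_apply,
        smul_eq_mul]
      ring
    have h2 := h.sum_lie_lie_diagonal_pos hlam hdis hH hm hblock
      (d := fun x => s * d x) hzw (fun e => hd (mul_left_cancel₀ hs e))
    rw [h1]
    have h3 := Finset.sum_nonpos fun x (_ : x ∈ Finset.univ) =>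
      Finset.sum_nonpos fun y (_ : y ∈ Finset.univ) => hterm x y
    linarith
  · have h1 : 0 ≤ ∑ x, ⁅H, s • ⁅diagonal d, H⁆ + t • R⁆ x x *
        ⁅H, s • ⁅diagonal d, H⁆ + t • R⁆ x x :=
      Finset.sum_nonneg fun x _ => mul_self_nonneg _
    have h2 : ∑ x, ∑ y, (m (l x) - m (l y)) * (lam x - lam y) *
        ((t * (single a b (1 : ℝ) - single b a 1 : Matrix _ _ ℝ) x y) ^ 2) < 0 := by
      refine Finset.sum_neg' (fun x _ => Finset.sum_nonpos fun y _ => hterm x y)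
        ⟨a, Finset.mem_univ _, Finset.sum_neg' (fun y _ => hterm a y) ⟨b, Finset.mem_univ _, ?_⟩⟩
      have h3 : ¬(b = a ∧ a = b) := fun e => hab' e.2
      rw [Matrix.sub_apply, single_apply_same, single_apply_of_ne _ _ _ _ _ h3, sub_zero, mul_one]
      exact mul_neg_of_neg_of_pos (mul_neg_of_pos_of_neg (by linarith) (by linarith))
        (by positivity)
    linarith

end IsFrame

end Isospectral

/-! ### Co-index one forces a single pair of consecutive eigenvalues -/

namespace Isospectral

variable {n : ℕ}

namespace BlockPartition

variable (α : BlockPartition n)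

/-- All blocks are singletons, except for the block `{i, j}`. -/
def IsPair (i j : Fin n) : Prop :=
  i ≠ j ∧ α.label i = α.label j ∧
    ∀ k l, α.label k = α.label l → k = l ∨ (k = i ∧ l = j) ∨ (k = j ∧ l = i)

variable {α}

theorem part_label_eq_singleton {k : Fin n} (hk : ∀ l, α.label l = α.label k → l = k) :
    α.part (α.label k) = {k} := by
  ext l
  rw [mem_part, Finset.mem_singleton]
  exact ⟨hk l, fun h => by rw [h]⟩

theorem mean_label_of_singleton (lam : Fin n → ℝ) {k : Fin n}
    (hk : ∀ l, α.label l = α.label k → l = k) : α.mean lam (α.label k) = lam k := by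
  rw [mean, size, part_label_eq_singleton hk]
  simp

namespace IsPair

variable {i j : Fin n}

theorem symm (h : α.IsPair i j) : α.IsPair j i :=
  ⟨h.1.symm, h.2.1.symm, fun k l hkl => (h.2.2 k l hkl).imp_right Or.symm⟩

theorem singleton (h : α.IsPair i j) {k : Fin n} (hi : k ≠ i) (hj : k ≠ j) (l : Fin n)
    (hl : α.label l = α.label k) : l = k := by
  rcases h.2.2 l k hl with h | ⟨-, h⟩ | ⟨-, h⟩
  exacts [h, (hj h).elim, (hi h).elim]

theorem part_eq (h : α.IsPair i j) : α.part (α.label i) = {i, j} := by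
  ext l
  rw [mem_part, Finset.mem_insert, Finset.mem_singleton]
  constructor
  · intro hl
    rcases h.2.2 l i hl with h | ⟨h, -⟩ | ⟨h, -⟩
    exacts [Or.inl h, Or.inl h, Or.inr h]
  · rintro (rfl | rfl)
    exacts [rfl, h.2.1.symm]

theorem mean_left (h : α.IsPair i j) (lam : Fin n → ℝ) :
    α.mean lam (α.label i) = (lam i + lam j) / 2 := by
  rw [mean, size, h.part_eq, Finset.sum_pair h.1, Finset.card_pair h.1]
  norm_num

theorem mean_right (h : α.IsPair i j) (lam : Fin n → ℝ) :
    α.mean lam (α.label j) = (lam i + lam j) / 2 := by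
  rw [← h.2.1, h.mean_left]

theorem mean_eq (h : α.IsPair i j) (lam : Fin n → ℝ) (a : Fin n) :
    α.mean lam (α.label a) = (lam a + lam (Equiv.swap i j a)) / 2 := by
  by_cases hi : a = i
  · rw [hi, Equiv.swap_apply_left, h.mean_left]
  by_cases hj : a = j
  · rw [hj, Equiv.swap_apply_right, h.mean_right, add_comm]
  rw [Equiv.swap_apply_of_ne_of_ne hi hj, mean_label_of_singleton lam (h.singleton hi hj)]
  ring

end IsPair

theorem exists_isPair {i j : Fin n} (hij : i ≠ j) : ∃ α : BlockPartition n, α.IsPair i j := by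
  -- Merging `j` into `i` and numbering the range of `f` gives surjective labels.
  let f : Fin n → Fin n := fun k => if k = j then i else k
  let e := Fintype.equivFin (Set.range f)
  have hlab : ∀ k l, e (Set.rangeFactorization f k) = e (Set.rangeFactorization f l) ↔
      f k = f l := by
    intro k l
    rw [e.apply_eq_iff_eq]
    exact Subtype.ext_iff
  refine ⟨⟨_, e ∘ Set.rangeFactorization f,
    e.surjective.comp Set.rangeFactorization_surjective⟩, hij, ?_, ?_⟩
  · refine (hlab i j).2 ?_
    simp [f]
  · intro k l hkl
    have h1 := (hlab k l).1 hkl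
    simp only [f] at h1
    split_ifs at h1 with hk hl hl
    · exact Or.inl (hk.trans hl.symm)
    · exact Or.inr (Or.inr ⟨hk, h1.symm⟩)
    · exact Or.inr (Or.inl ⟨h1, hl⟩)
    · exact Or.inl h1

/-- Only singletons would give co-index `0`; a repeated label outside one pair, or an eigenvalue
between the two members of the pair, would give at least `2`. -/
theorem exists_isPair_of_coindexAt_eq_one {lam : Fin n → ℝ} (hlam : StrictMono lam)
    (hdis : StronglyDisjoint lam) {σ : Equiv.Perm (Fin n)} {H : Matrix (Fin n) (Fin n) ℝ}
    (hH : H ∈ α.blockSet lam σ) (hco : coindexAt (α.blockSet lam σ) H = 1) :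
    ∃ i j : Fin n, (j : ℕ) = (i : ℕ) + 1 ∧ α.IsPair i j := by
  obtain ⟨U, hU⟩ := α.exists_isFrame hlam.injective hH
  have hM : ∀ K ∈ α.blockSet lam σ,
      (∀ x y, α.label (σ x) ≠ α.label (σ y) → K x y = 0) ∧
        ∀ x, K x x = α.mean lam (α.label (σ x)) := fun K hK => ⟨hK.2.1, hK.2.2.1⟩
  obtain ⟨hsymm, hblock, hm, -⟩ := hH
  have hex : ∃ i j, i < j ∧ α.label i = α.label j := by
    by_contra hno
    push Not at hno
    have hinj : ∀ k l, α.label l = α.label k → l = k := by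
      intro k l hkl
      rcases lt_trichotomy l k with h | h | h
      exacts [(hno _ _ h hkl).elim, h, (hno _ _ h hkl.symm).elim]
    refine zero_ne_one (Eq.trans (Eq.symm ?_) hco)
    refine hU.coindexAt_eq_zero hlam.injective _ fun A hA => ?_
    rw [hU.hessian_lie hlam.injective hm hA]
    have h1 : ∀ x, ⁅H, A⁆ x x = 0 := by
      intro x
      rw [lie_apply_self]
      refine Finset.sum_eq_zero fun y _ => ?_
      by_cases hxy : x = y
      · subst hxy; ring
      · have hne : α.label (σ x) ≠ α.label (σ y) := fun e => hxy (σ.injective (hinj _ _ e))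
        rw [hblock x y hne, hblock y x hne.symm]; ring
    simp only [h1, mul_zero, Finset.sum_const_zero, zero_sub, Left.neg_nonpos_iff]
    refine Finset.sum_nonneg fun a _ => Finset.sum_nonneg fun b _ => ?_
    rw [mean_label_of_singleton lam (hinj a), mean_label_of_singleton lam (hinj b)]
    exact mul_nonneg (mul_self_nonneg _) (mul_self_nonneg _)
  obtain ⟨i, j, hij, hlab⟩ := hex
  have hmem : ∀ k l, α.label k = α.label l → k ≠ l → k = i ∨ k = j := by
    intro k l hkl hne
    by_contra! hk
    -- The indicators of the rows of `i` and `k` are independent modulo functions constant on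
    -- blocks: `i` and `j` detect `s`, because `k` is neither of them, and `k` and `l` detect `t`
    -- when `s = 0`.
    refine (hU.one_lt_coindexAt_of_diagonal hlam.injective hdis hsymm hm hblock hM
      (d := Pi.single (σ.symm i) 1) (e := Pi.single (σ.symm k) 1) fun s t hst => ?_).ne' hco
    by_cases hs : s = 0
    · refine ⟨σ.symm k, σ.symm l, by simpa using hkl, ?_⟩
      have h1 : σ.symm l ≠ σ.symm k := fun e => hne (σ.symm.injective e).symm
      simpa [hs, Pi.single_eq_of_ne h1] using hst
    · refine ⟨σ.symm i, σ.symm j, by simpa using hlab, ?_⟩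
      have h1 : σ.symm j ≠ σ.symm i := fun e => hij.ne' (σ.symm.injective e)
      have h2 : σ.symm i ≠ σ.symm k := fun e => hk.1 (σ.symm.injective e).symm
      have h3 : σ.symm j ≠ σ.symm k := fun e => hk.2 (σ.symm.injective e).symm
      simpa [Pi.single_eq_of_ne h1, Pi.single_eq_of_ne h2, Pi.single_eq_of_ne h3] using hs
  have hpair : α.IsPair i j := by
    refine ⟨hij.ne, hlab, fun k l hkl => ?_⟩
    by_cases hne : k = l
    · exact Or.inl hne
    · rcases hmem k l hkl hne with rfl | rfl <;>
        rcases hmem l k hkl.symm (Ne.symm hne) with rfl | rfl <;> simp_all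
  refine ⟨i, j, ?_, hpair⟩
  by_contra hadj
  have hij' : (i : ℕ) < j := hij
  let k : Fin n := ⟨i + 1, by omega⟩
  have hik : i < k := Fin.lt_def.2 (by simp [k])
  have hkj : k < j := Fin.lt_def.2 (by simp only [k]; omega)
  have hmk := mean_label_of_singleton lam (hpair.singleton hik.ne' hkj.ne)
  have hne : (lam i + lam j) / 2 ≠ lam k := by
    have h1 := hdis {i, j} {k} (by simp) (by simp) (by simp [hik.ne', hkj.ne])
    rw [Finset.sum_pair hij.ne, Finset.card_pair hij.ne] at h1
    simpa using h1
  have hz : (Pi.single (σ.symm i) 1 : Fin n → ℝ) (σ.symm i) ≠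
      (Pi.single (σ.symm i) 1 : Fin n → ℝ) (σ.symm j) := by
    have h1 : σ.symm j ≠ σ.symm i := fun e => hij.ne' (σ.symm.injective e)
    simp [Pi.single_eq_of_ne h1]
  have hzw : α.label (σ (σ.symm i)) = α.label (σ (σ.symm j)) := by simpa using hlab
  -- If the mean of the pair is below `λ_k`, then `k` and `j` are inverted; if it is above, then `i`
  -- and `k` are.
  rcases lt_or_gt_of_ne hne with hlt | hlt
  · refine (hU.one_lt_coindexAt_of_inversion hlam.injective hdis hsymm hm hblock hM hzw hz
      (hlam hkj) ?_).ne' hco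
    rwa [hmk, hpair.mean_right]
  · refine (hU.one_lt_coindexAt_of_inversion hlam.injective hdis hsymm hm hblock hM hzw hz
      (hlam hik) ?_).ne' hco
    rwa [hmk, hpair.mean_left]

end BlockPartition

end Isospectral

/-! ### The critical manifold of a pair consists of two points -/

namespace Isospectral

variable {n : ℕ}

/-- Each entry of a curve in `M` has a range that is connected and finite in `ℝ`, hence is constant.
-/
theorem velocities_eq_zero_of_finite {M : Set (Matrix (Fin n) (Fin n) ℝ)} (hM : M.Finite)
    {H W : Matrix (Fin n) (Fin n) ℝ} (hW : W ∈ velocities M H) : W = 0 := by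
  obtain ⟨γ, hs, hγ, -, hd⟩ := hW
  ext x y
  have hfin : (Set.range fun t => γ t x y).Finite := by
    refine (hM.image fun K => K x y).subset ?_
    rintro _ ⟨t, rfl⟩
    exact ⟨_, hγ t, rfl⟩
  have hsub : (Set.range fun t => γ t x y).Subsingleton := by
    rw [← Set.not_nontrivial_iff]
    exact fun h => (isPreconnected_range (hs x y).continuous).infinite_of_nontrivial h hfin
  have hconst : (fun t => γ t x y) = fun _ => γ 0 x y :=
    funext fun t => hsub ⟨t, rfl⟩ ⟨0, rfl⟩
  have h1 := hd x y
  rw [hconst] at h1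
  exact h1.unique (hasDerivAt_const _ _)

namespace BlockPartition

variable {α : BlockPartition n} {lam : Fin n → ℝ} {i j : Fin n} {σ : Equiv.Perm (Fin n)}
  {H : Matrix (Fin n) (Fin n) ℝ}

namespace IsPair

theorem apply_eq_zero (h : α.IsPair i j) (hblock : ∀ x y, α.label (σ x) ≠ α.label (σ y) → H x y = 0)
    {x y : Fin n} (hne : x ≠ y) (hij : ¬(σ x = i ∧ σ y = j)) (hji : ¬(σ x = j ∧ σ y = i)) :
    H x y = 0 := by
  refine hblock x y fun e => ?_
  rcases h.2.2 _ _ e with h | h | h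
  exacts [hne (σ.injective h), hij h, hji h]

theorem sq_apply (h : α.IsPair i j) (hH : H ∈ α.blockSet lam σ) :
    H (σ.symm i) (σ.symm j) ^ 2 = ((lam j - lam i) / 2) ^ 2 := by
  obtain ⟨hsymm, hblock, hm, heig⟩ := hH
  obtain ⟨v, hv, hs, he⟩ := heig i
  have hne : σ.symm i ≠ σ.symm j := fun e => h.1 (σ.symm.injective e)
  have hsupp : ∀ x, x ≠ σ.symm i ∧ x ≠ σ.symm j → v x = 0 := by
    intro x hx
    refine hs x fun e => ?_
    rcases h.2.2 _ _ e with h1 | ⟨h1, -⟩ | ⟨h1, -⟩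
    · exact hx.1 (by rw [← h1, σ.symm_apply_apply])
    · exact hx.1 (by rw [← h1, σ.symm_apply_apply])
    · exact hx.2 (by rw [← h1, σ.symm_apply_apply])
  have hrow : ∀ x, H x (σ.symm i) * v (σ.symm i) + H x (σ.symm j) * v (σ.symm j) =
      lam i * v x := by
    intro x
    have h1 := congrFun he x
    rw [mulVec, dotProduct, Fintype.sum_eq_add _ _ hne
      (fun y hy => by rw [hsupp y hy, mul_zero])] at h1
    exact h1
  have h1 := hrow (σ.symm i)
  have h2 := hrow (σ.symm j)
  rw [hm, σ.apply_symm_apply, h.mean_left] at h1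
  rw [hm, σ.apply_symm_apply, h.mean_right, hsymm.apply] at h2
  set t := H (σ.symm i) (σ.symm j)
  -- With `δ = (λ_j - λ_i) / 2`, the two rows of the eigenvector equation for `λ_i` read `δ v_x + t
  -- v_y = 0` and `t v_x + δ v_y = 0`; the determinant is `δ² - t²`.
  have h3 : (((lam j - lam i) / 2) ^ 2 - t ^ 2) * v (σ.symm i) = 0 := by
    linear_combination (lam j - lam i) / 2 * h1 - t * h2
  have h4 : (((lam j - lam i) / 2) ^ 2 - t ^ 2) * v (σ.symm j) = 0 := by
    linear_combination (lam j - lam i) / 2 * h2 - t * h1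
  by_contra hsq
  have hsq' : ((lam j - lam i) / 2) ^ 2 - t ^ 2 ≠ 0 := fun e => hsq (by linarith)
  refine hv (funext fun x => ?_)
  by_cases hi : x = σ.symm i
  · rw [hi]; exact (mul_eq_zero.1 h3).resolve_left hsq'
  by_cases hj : x = σ.symm j
  · rw [hj]; exact (mul_eq_zero.1 h4).resolve_left hsq'
  exact hsupp x ⟨hi, hj⟩

theorem eq_pairMatrix (h : α.IsPair i j) (hlt : lam i < lam j) (hH : H ∈ α.blockSet lam σ) {ε : ℝ}
    (hε : H (σ.symm i) (σ.symm j) = ε * ((lam j - lam i) / 2)) :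
    H = pairMatrix lam σ (Equiv.swap i j * σ) ε := by
  obtain ⟨hsymm, hblock, hm, -⟩ := hH
  ext x y
  rw [pairMatrix, of_apply, Equiv.Perm.mul_apply, Equiv.Perm.mul_apply]
  have habs : |lam i - lam j| = lam j - lam i := by
    rw [abs_of_neg (by linarith)]; ring
  by_cases hxy : x = y
  · rw [if_pos hxy, ← hxy, hm, h.mean_eq]
  rw [if_neg hxy]
  by_cases hij : σ x = i ∧ σ y = j
  · rw [if_pos (by rw [hij.1, hij.2, Equiv.swap_apply_right]), hij.1, hij.2, habs]
    rw [← hij.1, ← hij.2, σ.symm_apply_apply, σ.symm_apply_apply, hij.1, hij.2] at hε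
    rw [hε]; ring
  by_cases hji : σ x = j ∧ σ y = i
  · rw [if_pos (by rw [hji.1, hji.2, Equiv.swap_apply_left]), hji.1, hji.2, abs_sub_comm, habs]
    rw [← hji.1, ← hji.2, σ.symm_apply_apply, σ.symm_apply_apply, hji.1, hji.2, hsymm.apply] at hε
    rw [hε]; ring
  rw [h.apply_eq_zero hblock hxy hij hji, if_neg]
  intro e
  by_cases hi : σ y = i
  · rw [hi, Equiv.swap_apply_left] at e
    exact hji ⟨e, hi⟩
  by_cases hj : σ y = j
  · rw [hj, Equiv.swap_apply_right] at e
    exact hij ⟨e, hj⟩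
  rw [Equiv.swap_apply_of_ne_of_ne hi hj] at e
  exact hxy (σ.injective e)

theorem pairMatrix_apply (hlt : lam i < lam j) (ε : ℝ) :
    pairMatrix lam σ (Equiv.swap i j * σ) ε (σ.symm i) (σ.symm j) =
      ε * ((lam j - lam i) / 2) := by
  have hne : σ.symm i ≠ σ.symm j := fun e => by
    rw [σ.symm.injective e] at hlt; exact lt_irrefl _ hlt
  rw [pairMatrix, of_apply, if_neg hne, Equiv.Perm.mul_apply, σ.apply_symm_apply,
    σ.apply_symm_apply, Equiv.swap_apply_right, if_pos rfl, abs_of_neg (by linarith)]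
  ring

theorem pairMatrix_mem_blockSet (h : α.IsPair i j) (hlt : lam i < lam j) {ε : ℝ} (hε : ε * ε = 1) :
    pairMatrix lam σ (Equiv.swap i j * σ) ε ∈ α.blockSet lam σ := by
  have hne : σ.symm i ≠ σ.symm j := fun e => h.1 (σ.symm.injective e)
  have hsymm : (pairMatrix lam σ (Equiv.swap i j * σ) ε).IsSymm := by
    ext x y
    simp only [transpose_apply, pairMatrix, of_apply, Equiv.Perm.mul_apply]
    by_cases hxy : x = y
    · subst hxy; rfl
    rw [if_neg hxy, if_neg (Ne.symm hxy), abs_sub_comm]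
    have : σ y = Equiv.swap i j (σ x) ↔ σ x = Equiv.swap i j (σ y) := by
      rw [← Equiv.swap_apply_eq_iff, eq_comm]
    exact if_congr this rfl rfl
  have hdiag : ∀ x, pairMatrix lam σ (Equiv.swap i j * σ) ε x x =
      α.mean lam (α.label (σ x)) := by
    intro x
    rw [h.mean_eq, pairMatrix, of_apply, if_pos rfl, Equiv.Perm.mul_apply]
  have hblock : ∀ x y, α.label (σ x) ≠ α.label (σ y) →
      pairMatrix lam σ (Equiv.swap i j * σ) ε x y = 0 := by
    intro x y hxy
    rw [pairMatrix, of_apply, if_neg (fun e => hxy (by rw [e])), if_neg]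
    rw [Equiv.Perm.mul_apply]
    intro e
    by_cases hi : σ y = i
    · rw [hi, Equiv.swap_apply_left] at e
      exact hxy (by rw [e, hi, h.2.1])
    by_cases hj : σ y = j
    · rw [hj, Equiv.swap_apply_right] at e
      exact hxy (by rw [e, hj, h.2.1])
    rw [Equiv.swap_apply_of_ne_of_ne hi hj] at e
    exact hxy (by rw [e])
  have hoff := pairMatrix_apply (σ := σ) hlt ε
  have hoff' : pairMatrix lam σ (Equiv.swap i j * σ) ε (σ.symm j) (σ.symm i) =
      ε * ((lam j - lam i) / 2) := by rw [hsymm.apply, hoff]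
  refine ⟨hsymm, hblock, hdiag, fun a => ?_⟩
  generalize pairMatrix lam σ (Equiv.swap i j * σ) ε = K at *
  -- The eigenvectors on the pair are `e_x + δ e_y` with `δ = ±ε`: `δ = -ε` belongs to `λ_i` and `δ
  -- = ε` to `λ_j`, because `ε² = 1`.
  have hpair : ∀ δ : ℝ, ∀ a, α.label a = α.label i →
      (lam i + lam j) / 2 + δ * ε * ((lam j - lam i) / 2) = lam a → δ * δ = 1 →
      ∃ v ≠ 0, (∀ x, α.label (σ x) ≠ α.label a → v x = 0) ∧ K *ᵥ v = lam a • v := by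
    intro δ a ha hδ hδ'
    refine ⟨Pi.single (σ.symm i) 1 + Pi.single (σ.symm j) δ, fun e => ?_, fun x hx => ?_, ?_⟩
    · have := congrFun e (σ.symm i)
      simp [Pi.single_eq_of_ne hne] at this
    · have h1 : x ≠ σ.symm i := by
        rintro rfl; rw [σ.apply_symm_apply] at hx; exact hx ha.symm
      have h2 : x ≠ σ.symm j := by
        rintro rfl; rw [σ.apply_symm_apply, ← h.2.1] at hx; exact hx ha.symm
      simp [Pi.single_eq_of_ne h1, Pi.single_eq_of_ne h2]
    · funext x
      rw [mulVec_add, Pi.add_apply, mulVec_single, mulVec_single]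
      simp only [Pi.smul_apply, MulOpposite.op_one, one_smul, col_apply, MulOpposite.smul_eq_mul_unop,
        MulOpposite.unop_op, Pi.add_apply, smul_eq_mul]
      by_cases hi : x = σ.symm i
      · subst hi
        rw [hoff, hdiag, σ.apply_symm_apply, h.mean_left, Pi.single_eq_same,
          Pi.single_eq_of_ne hne, ← hδ]
        ring
      by_cases hj : x = σ.symm j
      · subst hj
        rw [hoff', hdiag, σ.apply_symm_apply, h.mean_right, Pi.single_eq_same,
          Pi.single_eq_of_ne hne.symm, ← hδ]
        linear_combination (-ε * ((lam j - lam i) / 2)) * hδ'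
      · have hne' : ∀ b : Fin n, x ≠ σ.symm b → σ x ≠ b := by
          rintro b hb rfl; simp at hb
        have h1 := h.apply_eq_zero hblock hi (fun e => hne' i hi e.1) (fun e => hne' j hj e.1)
        have h2 := h.apply_eq_zero hblock hj (fun e => hne' i hi e.1) (fun e => hne' j hj e.1)
        rw [h1, h2, Pi.single_eq_of_ne hi, Pi.single_eq_of_ne hj]
        ring
  by_cases hi : a = i
  · refine hpair (-ε) a (by rw [hi]) ?_ (by rw [neg_mul_neg, hε])
    rw [hi]; linear_combination (-(lam j - lam i) / 2) * hε
  by_cases hj : a = j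
  · refine hpair ε a (by rw [hj, h.2.1]) ?_ hε
    rw [hj]; linear_combination ((lam j - lam i) / 2) * hε
  refine ⟨Pi.single (σ.symm a) 1, fun e => ?_, fun x hx => ?_, ?_⟩
  · have := congrFun e (σ.symm a)
    simp at this
  · refine Pi.single_eq_of_ne ?_ _
    rintro rfl
    simp at hx
  · funext x
    rw [mulVec_single_one, col_apply, Pi.smul_apply, smul_eq_mul]
    by_cases hx : x = σ.symm a
    · rw [hx, hdiag, σ.apply_symm_apply, mean_label_of_singleton lam (h.singleton hi hj),
        Pi.single_eq_same, mul_one]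
    · rw [Pi.single_eq_of_ne hx, mul_zero]
      refine h.apply_eq_zero hblock hx (fun e => hj ?_) (fun e => hi ?_)
      · simpa using e.2
      · simpa using e.2

theorem blockSet_eq_pairSet (h : α.IsPair i j) (hlt : lam i < lam j) (σ : Equiv.Perm (Fin n)) :
    α.blockSet lam σ = pairSet lam σ (Equiv.swap i j * σ) := by
  ext H
  rw [pairSet, Set.mem_insert_iff, Set.mem_singleton_iff]
  constructor
  · intro hH
    rcases sq_eq_sq_iff_eq_or_eq_neg.1 (h.sq_apply hH) with hs | hs
    · exact Or.inl (h.eq_pairMatrix hlt hH (by rw [hs, one_mul]))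
    · exact Or.inr (h.eq_pairMatrix hlt hH (by rw [hs]; ring))
  · rintro (rfl | rfl)
    · exact h.pairMatrix_mem_blockSet hlt (by norm_num)
    · exact h.pairMatrix_mem_blockSet hlt (by norm_num)

end IsPair

end BlockPartition

theorem ncard_pairSet {lam : Fin n → ℝ} {i j : Fin n} (hlt : lam i < lam j)
    (σ : Equiv.Perm (Fin n)) : (pairSet lam σ (Equiv.swap i j * σ)).ncard = 2 := by
  refine Set.ncard_pair fun e => ?_
  have h1 := congrFun (congrFun e (σ.symm i)) (σ.symm j)
  rw [BlockPartition.IsPair.pairMatrix_apply hlt, BlockPartition.IsPair.pairMatrix_apply hlt] at h1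
  linarith

end Isospectral

/-! ### The co-index at a pair of consecutive eigenvalues -/

namespace Isospectral

variable {n : ℕ}

namespace BlockPartition.IsPair

variable {α : BlockPartition n} {lam : Fin n → ℝ} {i j : Fin n} {σ : Equiv.Perm (Fin n)}
  {H : Matrix (Fin n) (Fin n) ℝ}

/-- For a pair of consecutive eigenvalues the means of the blocks are in the order of the
eigenvalues. -/
theorem mean_mul_nonneg (h : α.IsPair i j) (hlam : StrictMono lam) (hij : (j : ℕ) = (i : ℕ) + 1)
    (a b : Fin n) :
    0 ≤ (α.mean lam (α.label a) - α.mean lam (α.label b)) * (lam a - lam b) := by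
  have key : ∀ a b : Fin n, a < b → α.mean lam (α.label a) ≤ α.mean lam (α.label b) := by
    intro a b hab
    have hle : ∀ c d : Fin n, (c : ℕ) ≤ d → lam c ≤ lam d := fun c d hcd => hlam.monotone hcd
    have hab' : (a : ℕ) < b := hab
    have h0 := hle a b hab'.le
    rw [h.mean_eq, h.mean_eq]
    refine div_le_div_of_nonneg_right ?_ zero_le_two
    by_cases hai : a = i
    · subst hai
      rw [Equiv.swap_apply_left]
      by_cases hbj : b = j
      · subst hbj; rw [Equiv.swap_apply_right, add_comm]
      · have := hle j b (by omega)
        rw [Equiv.swap_apply_of_ne_of_ne hab.ne' hbj]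
        linarith
    by_cases haj : a = j
    · subst haj
      have h1 : b ≠ i := by rintro rfl; omega
      have := hle i b (by omega)
      rw [Equiv.swap_apply_right, Equiv.swap_apply_of_ne_of_ne h1 hab.ne']
      linarith
    rw [Equiv.swap_apply_of_ne_of_ne hai haj]
    by_cases hbi : b = i
    · subst hbi
      have := hle a j (by omega)
      rw [Equiv.swap_apply_left]; linarith
    by_cases hbj : b = j
    · subst hbj
      have h1 : (a : ℕ) ≠ i := fun e => hai (Fin.ext e)
      have := hle a i (by omega)
      rw [Equiv.swap_apply_right]; linarith
    rw [Equiv.swap_apply_of_ne_of_ne hbi hbj]; linarith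
  rcases lt_trichotomy a b with hab | rfl | hab
  · exact mul_nonneg_of_nonpos_of_nonpos (sub_nonpos.2 (key a b hab)) (sub_nonpos.2 (hlam hab).le)
  · simp
  · exact mul_nonneg (sub_nonneg.2 (key b a hab)) (sub_nonneg.2 (hlam hab).le)

theorem lie_apply_left (h : α.IsPair i j) (hH : H ∈ α.blockSet lam σ)
    {A : Matrix (Fin n) (Fin n) ℝ} (hA : Aᵀ = -A) :
    ⁅H, A⁆ (σ.symm i) (σ.symm i) = -2 * (H (σ.symm i) (σ.symm j) * A (σ.symm i) (σ.symm j)) := by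
  have hAe : ∀ x y, A y x = -A x y := fun x y => congrFun (congrFun hA x) y
  rw [lie_apply_self, Finset.sum_eq_single (σ.symm j)]
  · rw [hAe (σ.symm i) (σ.symm j), hH.1.apply]; ring
  · intro y _ hy
    by_cases hyi : y = σ.symm i
    · rw [hyi]; ring
    · have h1 : H (σ.symm i) y = 0 := by
        refine h.apply_eq_zero hH.2.1 (Ne.symm hyi) (fun e => hy ?_) (fun e => hyi ?_)
        · rw [← e.2, σ.symm_apply_apply]
        · rw [← e.2, σ.symm_apply_apply]
      rw [hH.1.apply (σ.symm i) y, h1]; ring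
  · simp

/-- The contribution of the diagonal entries to the Hessian. -/
theorem sum_lie_mul_lie (h : α.IsPair i j) (hH : H ∈ α.blockSet lam σ)
    {A B : Matrix (Fin n) (Fin n) ℝ} (hA : Aᵀ = -A) (hB : Bᵀ = -B) :
    ∑ x, ⁅H, A⁆ x x * ⁅H, B⁆ x x = 8 * H (σ.symm i) (σ.symm j) ^ 2 *
      (A (σ.symm i) (σ.symm j) * B (σ.symm i) (σ.symm j)) := by
  have hne : σ.symm i ≠ σ.symm j := fun e => h.1 (σ.symm.injective e)
  have hAe : A (σ.symm j) (σ.symm i) = -A (σ.symm i) (σ.symm j) := congrFun (congrFun hA _) _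
  have hBe : B (σ.symm j) (σ.symm i) = -B (σ.symm i) (σ.symm j) := congrFun (congrFun hB _) _
  rw [Fintype.sum_eq_add _ _ hne, h.lie_apply_left hH hA, h.lie_apply_left hH hB,
    h.symm.lie_apply_left hH hA, h.symm.lie_apply_left hH hB, hAe, hBe, hH.1.apply]
  · ring
  · rintro x ⟨hi, hj⟩
    rw [lie_apply_self, Finset.sum_eq_zero, zero_mul]
    intro y _
    by_cases hxy : x = y
    · rw [hxy]; ring
    · have h1 : H x y = 0 := by
        refine h.apply_eq_zero hH.2.1 hxy (fun e => hi ?_) (fun e => hj ?_)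
        · rw [← e.1, σ.symm_apply_apply]
        · rw [← e.1, σ.symm_apply_apply]
      rw [hH.1.apply x y, h1]; ring

theorem coindexAt_eq_one (h : α.IsPair i j) (hlam : StrictMono lam) (hij : (j : ℕ) = (i : ℕ) + 1)
    (hH : H ∈ α.blockSet lam σ) : coindexAt (α.blockSet lam σ) H = 1 := by
  have hlt : lam i < lam j := hlam (Fin.lt_def.2 (by omega))
  have hinj := hlam.injective
  have hne : σ.symm i ≠ σ.symm j := fun e => h.1 (σ.symm.injective e)
  obtain ⟨U, hU⟩ := α.exists_isFrame hinj hH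
  have hm := hH.2.2.1
  -- A finite set has only zero velocities, so the normal space is the whole tangent space.
  have hN : ∀ A : Matrix (Fin n) (Fin n) ℝ, Aᵀ = -A →
      ⁅H, A⁆ ∈ normalSpace (α.blockSet lam σ) H := by
    refine fun A hA => ⟨⟨A, hA, rfl⟩, fun W hW => ?_⟩
    have hfin : (α.blockSet lam σ).Finite := by
      rw [h.blockSet_eq_pairSet hlt]
      exact (Set.finite_singleton _).insert _
    have h0 : (0 : Matrix (Fin n) (Fin n) ℝ) = ⁅H, (0 : Matrix (Fin n) (Fin n) ℝ)⁆ := by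
      simp [Ring.lie_def]
    rw [velocities_eq_zero_of_finite hfin hW, h0, hU.normalMetric_lie hinj hA (by simp)]
    simp
  let R : Matrix (Fin n) (Fin n) ℝ :=
    single (σ.symm i) (σ.symm j) 1 - single (σ.symm j) (σ.symm i) 1
  have hR : Rᵀ = -R := by
    simp only [R, transpose_sub, transpose_single, neg_sub]
  have hRij : R (σ.symm i) (σ.symm j) = 1 := by
    simp [R, hne.symm]
  have hRU : ∀ a b, α.label a ≠ α.label b → (Uᵀ * R * U) a b = 0 := by
    intro a b hab
    refine hU.conj_eq_zero (fun x y hxy => ?_) hab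
    have h1 : ¬(σ.symm i = x ∧ σ.symm j = y) := by
      rintro ⟨rfl, rfl⟩; simp [h.2.1] at hxy
    have h2 : ¬(σ.symm j = x ∧ σ.symm i = y) := by
      rintro ⟨rfl, rfl⟩; simp [h.2.1] at hxy
    simp only [R]
    rw [Matrix.sub_apply, single_apply_of_ne _ _ _ _ _ h1, single_apply_of_ne _ _ _ _ _ h2,
      sub_zero]
  have hgR : ∀ A : Matrix (Fin n) (Fin n) ℝ, Aᵀ = -A →
      normalMetric H ⁅H, R⁆ ⁅H, A⁆ = 2 * A (σ.symm i) (σ.symm j) := by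
    intro A hA
    have hAe : A (σ.symm j) (σ.symm i) = -A (σ.symm i) (σ.symm j) := congrFun (congrFun hA _) _
    rw [normalMetric, hU.adInv_lie hinj hR, hU.adInv_lie hinj hA, Matrix.sub_mul, trace_sub,
      trace_single_mul, trace_single_mul, hAe]
    simp only [smul_eq_mul]
    ring
  have ht : 0 < 4 * H (σ.symm i) (σ.symm j) ^ 2 := by
    rw [h.sq_apply hH]
    have : 0 < (lam j - lam i) / 2 := by linarith
    positivity
  -- The Hessian of `[H, R]` with `[H, A]` is `8 h_xy² A_xy` and the metric is `2 A_xy`, whence the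
  -- eigenvalue `4 h_xy²`; the second sum vanishes because `R` is supported on the block of the
  -- pair.
  have hRmem : ⁅H, R⁆ ∈ hessianEigenvectors (α.blockSet lam σ) H
      (4 * H (σ.symm i) (σ.symm j) ^ 2) := by
    refine ⟨hN R hR, fun W hW => ?_⟩
    obtain ⟨A, hA, rfl⟩ := hW.1
    rw [hU.hessian_lie hinj hm hA, hgR A hA, h.sum_lie_mul_lie hH hR hA, hRij,
      Finset.sum_eq_zero (fun a _ => Finset.sum_eq_zero fun b _ => ?_)]
    · ring
    · by_cases hab : α.label a = α.label b
      · rw [hab]; ring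
      · rw [hRU a b hab]; ring
  have hR0 : ⁅H, R⁆ ≠ 0 := by
    intro e
    have h1 := hgR R hR
    have h2 : normalMetric H 0 0 = 0 := by
      have h0 : (0 : Matrix (Fin n) (Fin n) ℝ) = ⁅H, (0 : Matrix (Fin n) (Fin n) ℝ)⁆ := by
        simp [Ring.lie_def]
      rw [h0, hU.normalMetric_lie hinj (by simp) (by simp)]
      simp
    rw [e, h2, hRij] at h1
    norm_num at h1
  have hspan : Submodule.span ℝ (⋃ r ∈ Set.Ioi (0 : ℝ),
      hessianEigenvectors (α.blockSet lam σ) H r) = Submodule.span ℝ {⁅H, R⁆} := by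
    refine le_antisymm (Submodule.span_le.2 fun V hV => ?_) (Submodule.span_mono ?_)
    swap
    · rw [Set.singleton_subset_iff]
      simp only [Set.mem_iUnion]
      exact ⟨_, ht, hRmem⟩
    simp only [Set.mem_iUnion] at hV
    obtain ⟨r, hr, hVN, hV⟩ := hV
    obtain ⟨A, hA, rfl⟩ := hVN.1
    -- Split off the component along `R`. Pairing the eigenvector `[H, A]` with `[H, B]` makes the
    -- diagonal term vanish as `B_xy = 0`; there being no inversions, the Hessian is nonpositive,
    -- yet it equals `r` times the squared norm of `B`. So `B = 0`.
    obtain ⟨B, w, hAB, hB0⟩ : ∃ (B : Matrix (Fin n) (Fin n) ℝ) (w : ℝ), A = w • R + B ∧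
        B (σ.symm i) (σ.symm j) = 0 := by
      refine ⟨A - A (σ.symm i) (σ.symm j) • R, A (σ.symm i) (σ.symm j), by abel, ?_⟩
      rw [Matrix.sub_apply, Matrix.smul_apply, hRij, smul_eq_mul, mul_one, sub_self]
    have hB : Bᵀ = -B := by
      have h1 : B = A - w • R := by rw [hAB]; abel
      rw [h1, transpose_sub, transpose_smul, hA, hR, smul_neg]
      abel
    have h1 := hV _ (hN B hB)
    have h2 : normalMetric H ⁅H, A⁆ ⁅H, B⁆ = ∑ x, ∑ y, B x y * B x y := by
      have h3 := hgR B hB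
      rw [hU.normalMetric_lie hinj hR hB, hB0, mul_zero] at h3
      rw [hU.normalMetric_lie hinj hA hB, hAB]
      simp only [Matrix.add_apply, Matrix.smul_apply, smul_eq_mul, add_mul, mul_assoc,
        Finset.sum_add_distrib, ← Finset.mul_sum, h3, mul_zero, zero_add]
    have h3 : 0 ≤ ∑ a, ∑ b, (α.mean lam (α.label a) - α.mean lam (α.label b)) *
        (lam a - lam b) * ((Uᵀ * A * U) a b * (Uᵀ * B * U) a b) := by
      refine Finset.sum_nonneg fun a _ => Finset.sum_nonneg fun b _ => ?_
      by_cases hab : α.label a = α.label b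
      · rw [hab, sub_self, zero_mul, zero_mul]
      · have h4 : (Uᵀ * A * U) a b = (Uᵀ * B * U) a b := by
          rw [hAB, Matrix.mul_add, Matrix.add_mul, Matrix.add_apply, mul_smul_comm, smul_mul_assoc,
            Matrix.smul_apply, hRU a b hab, smul_zero, zero_add]
        rw [h4]
        exact mul_nonneg (h.mean_mul_nonneg hlam hij a b) (mul_self_nonneg _)
    rw [hU.hessian_lie hinj hm hB, h.sum_lie_mul_lie hH hA hB, hB0, mul_zero, mul_zero, zero_sub,
      h2] at h1
    have h4 : ∑ x, ∑ y, B x y * B x y = 0 := by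
      refine le_antisymm (nonpos_of_mul_nonpos_right ?_ hr)
        (Finset.sum_nonneg fun x _ => Finset.sum_nonneg fun y _ => mul_self_nonneg _)
      rw [← h1]
      exact neg_nonpos.2 h3
    rw [hAB, eq_zero_of_sum_mul_self_eq_zero h4, add_zero]
    refine Submodule.mem_span_singleton.2 ⟨w, ?_⟩
    simp only [Ring.lie_def, smul_sub, mul_smul_comm, smul_mul_assoc]
  rw [coindexAt, hspan, finrank_span_singleton hR0]

end BlockPartition.IsPair

end Isospectral

theorem mainTheorem6 (n : ℕ) (lam : Fin n → ℝ) (hlam : StrictMono lam)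
    (hdis : Isospectral.StronglyDisjoint lam) :
    (∀ α : Isospectral.BlockPartition n,
      (∃ H ∈ α.critSet lam, Isospectral.coindexAt (α.critSet lam) H = 1) →
      ∃ p : Fin α.k,
        (∀ q : Fin α.k, q ≠ p → ∃ a : Fin n, α.part q = {a}) ∧
        ∃ i j : Fin n, (j : ℕ) = (i : ℕ) + 1 ∧ α.part p = {i, j}) ∧
    (∀ M : Set (Matrix (Fin n) (Fin n) ℝ), Isospectral.IsCriticalManifold lam M →
      (∃ H ∈ M, Isospectral.coindexAt M H = 1) →
      M.ncard = 2 ∧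
        ∃ σ₁ σ₂ : Equiv.Perm (Fin n), Isospectral.SimplyRelated σ₁ σ₂ ∧
          M = Isospectral.pairSet lam σ₁ σ₂) ∧
    (∀ σ₁ σ₂ : Equiv.Perm (Fin n), Isospectral.SimplyRelated σ₁ σ₂ →
      Isospectral.IsCriticalManifold lam (Isospectral.pairSet lam σ₁ σ₂) ∧
        ∀ H ∈ Isospectral.pairSet lam σ₁ σ₂,
          Isospectral.coindexAt (Isospectral.pairSet lam σ₁ σ₂) H = 1) := by
  refine ⟨?_, ?_, ?_⟩
  · rintro α ⟨H, hH, hco⟩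
    rw [α.critSet_eq_blockSet hlam.injective] at hH hco
    obtain ⟨i, j, hij, hp⟩ :=
      Isospectral.BlockPartition.exists_isPair_of_coindexAt_eq_one hlam hdis hH hco
    refine ⟨α.label i, fun q hq => ?_, i, j, hij, hp.part_eq⟩
    obtain ⟨k, rfl⟩ := α.surj q
    refine ⟨k, Isospectral.BlockPartition.part_label_eq_singleton (hp.singleton ?_ ?_)⟩
    · rintro rfl; exact hq rfl
    · rintro rfl; exact hq hp.2.1.symm
  · rintro M hM ⟨H, hH, hco⟩
    obtain ⟨α, σ, rfl⟩ := (Isospectral.isCriticalManifold_iff hlam.injective M).1 hM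
    obtain ⟨i, j, hij, hp⟩ :=
      Isospectral.BlockPartition.exists_isPair_of_coindexAt_eq_one hlam hdis hH hco
    have hlt : lam i < lam j := hlam (Fin.lt_def.2 (by omega))
    have hset := hp.blockSet_eq_pairSet hlt σ
    refine ⟨?_, σ, Equiv.swap i j * σ, ⟨i, j, hij, rfl⟩, hset⟩
    rw [hset, Isospectral.ncard_pairSet hlt]
  · rintro σ₁ _ ⟨i, j, hij, rfl⟩
    have hlt' : i < j := Fin.lt_def.2 (by omega)
    obtain ⟨α, hp⟩ := Isospectral.BlockPartition.exists_isPair hlt'.ne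
    rw [← hp.blockSet_eq_pairSet (hlam hlt') σ₁]
    exact ⟨(Isospectral.isCriticalManifold_iff hlam.injective _).2 ⟨α, σ₁, rfl⟩,
      fun H hH => hp.coindexAt_eq_one hlam hij hH⟩
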